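/- **Definitions.** Let $\mathrm{Cob}$ be Bar-Natan's dotted cobordism category for four boundary points, with $\mathbb Z$ coefficients and $\alpha=0$. Its objects are formally $q$-graded planar diagrams $q^jD$, where $D$ is the diagram $\asymp$ (the *turnback*: a top arc and a bottom arc) or the diagram $)($ (two vertical strands, left and right). Morphisms $q^iA\to q^jB$ are $\mathbb Z$-linear combinations of orientable dotted cobordisms $A\to B$ (of arbitrary degree), up to homeomorphism relative to the boundary, modulo the local relations: a sphere with $0,1,2,3$ dots equals $0,1,0,\alpha=0$ respectively, and a surface with a neck is the sum of the two surfaces obtained by cutting the neck, capping both ends by disks, and placing one dot on one of the two disks. Composition is gluing. (Diagrams with closed circles may be omitted, as they are isomorphic to direct sums of shifts of these.) Let $P_2=(C_*,d_*)$ be the second projector, the complex of formal direct sums of objects of $\mathrm{Cob}$ with $$C_0=\;)(\,,\qquad C_n=q^{2n-1}\asymp\ (n>0),\qquad C_n=0\ (n<0),$$ whose differential $d_n\colon C_n\to C_{n+1}$ is the saddle $s\colon )(\to\asymp$ for $n=0$, $t-t'$ for odd $n>0$, and $t+t'$ for even $n>0$, where $t$ and $t'$ are the identity cobordisms of $\asymp$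 with a dot on the top, respectively bottom, sheet. The sheet algebra $\mathrm{End}(P_2)$ is the differential graded algebra whose degree $k$ part is $\prod_n\mathrm{Hom}(C_n,C_{n+k})$, with product the composition and differential the graded commutator $f\mapsto d\circ f-(-1)^{|f|}f\circ d$. Let $H=\bigoplus_{k\in\mathbb Z}H^k(\mathrm{End}(P_2))$ be its homology, a ring under composition. **Theorem.** The following elements of $\mathrm{End}(P_2)$ are cycles: * $b$ of degree $0$, with component $C_0\to C_0$ the identity cobordism of $)($ with a dot on the left sheet, and component $C_n\to C_n$ equal to $t$ for $n>0$; * $u$ of degree $-2$, with component $C_2\to C_0$ the saddle $\asymp\,\to\,)($, and component $C_{n+2}\to C_n$ the identity cobordism of $\asymp$ for $n>0$; * $w$ of degree $-3$, with component $C_3\to C_0$ the saddle $\asymp\,\to\,)($ with one dot, and component $C_{n+3}\to C_n$ equal to $t$ for $n>0$; all other components being zero. Denote their classes in $H$ by the same letters. The map $$\mathbb Z[X]\oplus\mathbb Z[X]\oplus\mathbb Z[X]/(2X)\longrightarrow H,\qquad (p,q,[r])\longmapsto p(u)+q(u)\,w+r(u)\,b$$ is well defined and an isomorphism of abelian groups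 (hence of $\mathbb Z[u]$-modules, $\mathbb Z[u]$ acting on $H$ by multiplication), that is, $$H=\mathbb Z[u]\oplus\mathbb Z[u]\cdot w\oplus\mathbb Z[u]/(2u)\cdot b .$$ The multiplication of $H$ is commutative, and $w\cdot b=b^2=w^2=0$. -/

import Mathlib

open CategoryTheory CochainComplex CochainComplex.HomComplex
open scoped DirectSum

noncomputable section

namespace SheetAlgebra

/-! ## Dotted cobordisms between the planar diagrams with four boundary points -/

/-- The two Temperley-Lieb diagrams with four boundary points and without closed circles. Each of
them consists of two arcs: the first and the second arc of `straight` (two vertical strands) are its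
left and its right strand, those of `turnback` (a cup above a cap) are its top and its bottom arc. -/
inductive Diagram
  | straight
  | turnback

/-- The topological type of a connected orientable dotted surface with given boundary: its genus
and its number of dots. Addition is the connected sum. -/
abbrev Decor := ℕ × ℕ

/-- A handle. -/
def Decor.handle : Decor := (1, 0)

/-- A dot. -/
def Decor.dot : Decor := (0, 1)

/-- The first or the second arc of a diagram. -/
inductive Arc
  | first
  | second

/-- The part of a dotted cobordism `A → B` consisting of the components which meet the boundary,
up to homeomorphism relative to the boundary.

The boundary of a cobordism `A → B` is the closed curve `A ∪ (4 points × [0,1]) ∪ B`. For `A = B` it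
has two circles, one through each arc of `A`. These circles bound two different components
(`pair p q`, where `p` is the component through the first arc and `q` the one through the second
arc), or a single one (`tube p`). For `A ≠ B` the boundary is one circle, hence there is a single
component (`saddle p` and `cosaddle p`); the saddle has genus `0`. -/
inductive Sheets : Diagram → Diagram → Type
  | pair (A : Diagram) (p q : Decor) : Sheets A A
  | tube (A : Diagram) (p : Decor) : Sheets A A
  | saddle (p : Decor) : Sheets .straight .turnback
  | cosaddle (p : Decor) : Sheets .turnback .straight

namespace Sheets

/-- Gluing along the two arcs of the middle diagram. Components which meet are joined, dots are
added up, and genera are determined by additivity of the Euler characteristic: gluing along an arc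
lowers it by one, and a component of genus `g` with `r` boundary circles has Euler characteristic
`2 - 2 g - r`. For example, two tubes glued along two arcs have Euler characteristic
`0 + 0 - 2 = 2 - 2 * 1 - 2`, so the result is a tube with an additional handle. -/
def comp : {A B C : Diagram} → Sheets A B → Sheets B C → Sheets A C
  | _, _, _, pair A p q, pair _ p' q' => pair A (p + p') (q + q')
  | _, _, _, pair A p q, tube _ r => tube A (p + q + r)
  | _, _, _, tube A r, pair _ p q => tube A (r + (p + q))
  | _, _, _, tube A r, tube _ r' => tube A (r + r' + Decor.handle)
  | _, _, _, pair _ p q, saddle r => saddle (p + q + r)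
  | _, _, _, tube _ r, saddle r' => saddle (r + r' + Decor.handle)
  | _, _, _, saddle r, pair _ p q => saddle (r + (p + q))
  | _, _, _, saddle r, tube _ r' => saddle (r + r' + Decor.handle)
  | _, _, _, pair _ p q, cosaddle r => cosaddle (p + q + r)
  | _, _, _, tube _ r, cosaddle r' => cosaddle (r + r' + Decor.handle)
  | _, _, _, cosaddle r, pair _ p q => cosaddle (r + (p + q))
  | _, _, _, cosaddle r, tube _ r' => cosaddle (r + r' + Decor.handle)
  | _, _, _, saddle r, cosaddle r' => tube .straight (r + r')
  | _, _, _, cosaddle r, saddle r' => tube .turnback (r + r')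

/-- Connected sum of the component through the given arc of the source with a closed surface of
genus `p.1` with `p.2` dots. -/
def attach {A B : Diagram} (S : Sheets A B) (i : Arc) (p : Decor) : Sheets A B :=
  match S, i with
  | pair A q r, .first => pair A (q + p) r
  | pair A q r, .second => pair A q (r + p)
  | tube A q, _ => tube A (q + p)
  | saddle q, _ => saddle (q + p)
  | cosaddle q, _ => cosaddle (q + p)

theorem comp_assoc {A B C D : Diagram} (S : Sheets A B) (T : Sheets B C) (U : Sheets C D) :
    (S.comp T).comp U = S.comp (T.comp U) := by
  cases S <;> cases T <;> cases U <;> simp only [comp] <;> congr 1 <;> abel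

end Sheets

/-- A dotted cobordism `A → B`: its components which meet the boundary together with its closed
components. -/
@[ext]
structure Cobordism (A B : Diagram) where
  sheets : Sheets A B
  closed : Multiset Decor

namespace Cobordism

/-- The connected sum of the component through the given arc of the source with a closed surface. -/
def attach {A B : Diagram} (S : Cobordism A B) (i : Arc) (p : Decor) : Cobordism A B :=
  ⟨S.sheets.attach i p, S.closed⟩

/-- Disjoint union with a connected closed surface of genus `p.1` with `p.2` dots. -/
def addClosed {A B : Diagram} (S : Cobordism A B) (p : Decor) : Cobordism A B :=
  ⟨S.sheets, p ::ₘ S.closed⟩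

/-- The identity cobordism of `A` with extra decorations `p` and `q` on its first and second
component. -/
def decoratedId (A : Diagram) (p q : Decor) : Cobordism A A := ⟨.pair A p q, 0⟩

end Cobordism

/-- A formally `q`-graded diagram `q ^ shift • diagram`. -/
@[ext]
structure QDiagram where
  diagram : Diagram
  shift : ℤ

/-- The category of formally `q`-graded diagrams and dotted cobordisms of arbitrary degree; the
composition is gluing. -/
instance : Category QDiagram where
  Hom X Y := Cobordism X.diagram Y.diagram
  id X := Cobordism.decoratedId X.diagram 0 0
  comp S T := ⟨S.sheets.comp T.sheets, S.closed + T.closed⟩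
  id_comp := by
    rintro ⟨_, _⟩ ⟨_, _⟩ ⟨S, c⟩
    cases S <;> simp [Cobordism.decoratedId, Sheets.comp]
  comp_id := by
    rintro ⟨_, _⟩ ⟨_, _⟩ ⟨S, c⟩
    cases S <;> simp [Cobordism.decoratedId, Sheets.comp]
  assoc S T U := by
    simp only [Sheets.comp_assoc, add_assoc]

section Relations

variable (R : Type) [CommRing R]

/-- A cobordism as a basis element of the free `R`-module of morphisms. -/
def gen {X Y : QDiagram} (S : Cobordism X.diagram Y.diagram) : Free.of R X ⟶ Free.of R Y :=
  (Free.embedding R QDiagram).map (X := X) (Y := Y) S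

/-- The smallest `R`-linear congruence on linear combinations of cobordisms which contains the local
relations: a sphere with `0`, `1`, `2`, `3` dots evaluates to `0`, `1`, `0`, `α`, and neck-cutting: a
surface with a neck is the sum of the two surfaces obtained by cutting the neck, capping off the two
ends by disks, and placing a dot on one of these two disks. -/
inductive CobRel (α : R) : ∀ {X Y : Free R QDiagram}, (X ⟶ Y) → (X ⟶ Y) → Prop
  | sphere {X Y : QDiagram} (S : Cobordism X.diagram Y.diagram) :
      CobRel α (gen R (X := X) (Y := Y) (S.addClosed (0, 0))) 0
  | sphereDot {X Y : QDiagram} (S : Cobordism X.diagram Y.diagram) :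
      CobRel α (gen R (X := X) (Y := Y) (S.addClosed (0, 1))) (gen R S)
  | sphereDotDot {X Y : QDiagram} (S : Cobordism X.diagram Y.diagram) :
      CobRel α (gen R (X := X) (Y := Y) (S.addClosed (0, 2))) 0
  | sphereDotDotDot {X Y : QDiagram} (S : Cobordism X.diagram Y.diagram) :
      CobRel α (gen R (X := X) (Y := Y) (S.addClosed (0, 3))) (α • gen R S)
  /-- A non-separating neck of a component which meets the boundary. -/
  | neckHandle {X Y : QDiagram} (S : Cobordism X.diagram Y.diagram) (i : Arc) :
      CobRel α (gen R (X := X) (Y := Y) (S.attach i Decor.handle))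
        (gen R (S.attach i Decor.dot) + gen R (S.attach i Decor.dot))
  /-- A neck which separates a closed surface from a component which meets the boundary. -/
  | neckBubble {X Y : QDiagram} (S : Cobordism X.diagram Y.diagram) (i : Arc) (p : Decor) :
      CobRel α (gen R (X := X) (Y := Y) (S.attach i p))
        (gen R ((S.attach i Decor.dot).addClosed p) + gen R (S.addClosed (p + Decor.dot)))
  /-- A neck which separates the two boundary circles of a component. -/
  | neckTube (A : Diagram) (m n : ℤ) (p q : Decor) (c : Multiset Decor) :
      CobRel α (gen R (X := ⟨A, m⟩) (Y := ⟨A, n⟩) ⟨.tube A (p + q), c⟩)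
        (gen R ⟨.pair A (p + Decor.dot) q, c⟩ + gen R ⟨.pair A p (q + Decor.dot), c⟩)
  /-- A non-separating neck of a closed component. -/
  | neckClosedHandle {X Y : QDiagram} (S : Cobordism X.diagram Y.diagram) (p : Decor) :
      CobRel α (gen R (X := X) (Y := Y) (S.addClosed (p + Decor.handle)))
        (gen R (S.addClosed (p + Decor.dot)) + gen R (S.addClosed (p + Decor.dot)))
  /-- A separating neck of a closed component. -/
  | neckClosed {X Y : QDiagram} (S : Cobordism X.diagram Y.diagram) (p q : Decor) :
      CobRel α (gen R (X := X) (Y := Y) (S.addClosed (p + q)))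
        (gen R ((S.addClosed (p + Decor.dot)).addClosed q)
          + gen R ((S.addClosed p).addClosed (q + Decor.dot)))
  | refl {X Y : Free R QDiagram} (f : X ⟶ Y) : CobRel α f f
  | symm {X Y : Free R QDiagram} {f g : X ⟶ Y} : CobRel α f g → CobRel α g f
  | trans {X Y : Free R QDiagram} {f g h : X ⟶ Y} : CobRel α f g → CobRel α g h → CobRel α f h
  | add {X Y : Free R QDiagram} {f f' g g' : X ⟶ Y} :
      CobRel α f f' → CobRel α g g' → CobRel α (f + g) (f' + g')
  | smul {X Y : Free R QDiagram} (c : R) {f f' : X ⟶ Y} : CobRel α f f' → CobRel α (c • f) (c • f')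
  | comp {X Y Z : Free R QDiagram} {f f' : X ⟶ Y} {g g' : Y ⟶ Z} :
      CobRel α f f' → CobRel α g g' → CobRel α (f ≫ g) (f' ≫ g')

/-- The local relations as a relation on the morphisms of a category. -/
def cobRel (α : R) : HomRel (Free R QDiagram) := fun _ _ f g => CobRel R α f g

instance (α : R) : Congruence (cobRel R α) where
  comp_left f _ _ h := CobRel.comp (CobRel.refl f) h
  comp_right g h := CobRel.comp h (CobRel.refl g)
  equivalence := ⟨CobRel.refl, CobRel.symm, CobRel.trans⟩

/-- The category of formally `q`-graded diagrams with four boundary points and `R`-linear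
combinations of dotted cobordisms modulo the local relations. (Diagrams with closed circles are
left out; they are isomorphic to direct sums of shifts of the diagrams considered here.) -/
abbrev Cob (α : R) := Quotient (cobRel R α)

instance (α : R) : Preadditive (Cob R α) :=
  Quotient.preadditive (cobRel R α) fun _ _ _ _ _ _ h h' => CobRel.add h h'

end Relations

/-! ## The second projector -/

section Projector

variable (R : Type) [CommRing R] (α : R)

/-- The one-term formal direct sum `q ^ n • A`. -/
def qObj (A : Diagram) (n : ℤ) : Mat_ (Cob R α) :=
  (Mat_.embedding (Cob R α)).obj ((Quotient.functor (cobRel R α)).obj (Free.of R ⟨A, n⟩))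

/-- The morphism between one-term formal direct sums given by a cobordism. -/
def qHom {A B : Diagram} (m n : ℤ) (S : Cobordism A B) : qObj R α A m ⟶ qObj R α B n :=
  (Mat_.embedding (Cob R α)).map
    ((Quotient.functor (cobRel R α)).map (gen R (X := ⟨A, m⟩) (Y := ⟨B, n⟩) S))

/-- The saddle from the two vertical strands to the turnback. -/
def saddle : Cobordism .straight .turnback := ⟨.saddle 0, 0⟩

/-- The saddle from the turnback to the two vertical strands. -/
def cosaddle : Cobordism .turnback .straight := ⟨.cosaddle 0, 0⟩

/-- The dotted saddle from the turnback to the two vertical strands. -/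
def dottedCosaddle : Cobordism .turnback .straight := ⟨.cosaddle Decor.dot, 0⟩

/-- The identity cobordism of the turnback. -/
def turnbackId : Cobordism .turnback .turnback := .decoratedId .turnback 0 0

/-- The identity cobordism of the turnback with a dot on the top sheet. -/
def topDot : Cobordism .turnback .turnback := .decoratedId .turnback Decor.dot 0

/-- The identity cobordism of the turnback with a dot on the bottom sheet. -/
def bottomDot : Cobordism .turnback .turnback := .decoratedId .turnback 0 Decor.dot

/-- The identity cobordism of the two vertical strands with a dot on the left sheet. -/
def leftDot : Cobordism .straight .straight := .decoratedId .straight Decor.dot 0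

/-- The endomorphism (up to shifts) of the turnback which is the differential of the second projector
in degree `i > 0`: the difference of the top and the bottom dot for odd `i`, their sum for even
`i`. -/
def dotMap (i : ℕ) (m n : ℤ) : qObj R α .turnback m ⟶ qObj R α .turnback n :=
  if Odd i then qHom R α m n topDot - qHom R α m n bottomDot
  else qHom R α m n topDot + qHom R α m n bottomDot

/-- The chain groups of the second projector: `C_0` is the diagram of two vertical strands,
`C_n = q ^ (2 n - 1) • turnback` for `n > 0`, and `C_n = 0` for `n < 0`. -/
def chainObj : ℤ → Mat_ (Cob R α)
  | .ofNat 0 => qObj R α .straight 0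
  | .ofNat (n + 1) => qObj R α .turnback (2 * ((n : ℤ) + 1) - 1)
  | .negSucc _ => ⟨PEmpty, PEmpty.elim⟩

/-- The differential `C_i → C_j` of the second projector for `i + 1 = j`: a saddle for `i = 0`, the
difference of the top and the bottom dot for odd `i > 0`, their sum for even `i > 0`. -/
def chainD : (i j : ℤ) → (chainObj R α i ⟶ chainObj R α j)
  | .ofNat 0, .ofNat (_ + 1) => qHom R α _ _ saddle
  | .ofNat (n + 1), .ofNat (_ + 1) => dotMap R α (n + 1) _ _
  | _, _ => 0

theorem qHom_comp {A B C : Diagram} (l m n : ℤ) (S : Cobordism A B) (T : Cobordism B C) :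
    qHom R α l m S ≫ qHom R α m n T =
      qHom R α l n ⟨S.sheets.comp T.sheets, S.closed + T.closed⟩ := by
  unfold qHom
  exact ((Mat_.embedding (Cob R α)).map_comp _ _).symm.trans (congrArg _
    (((Quotient.functor (cobRel R α)).map_comp _ _).symm.trans (congrArg _
      ((Free.embedding R QDiagram).map_comp (X := ⟨A, l⟩) (Y := ⟨B, m⟩) (Z := ⟨C, n⟩) S T).symm)))

theorem qHom_twoDots (m n : ℤ) (i : Arc) :
    qHom R α m n ((Cobordism.decoratedId .turnback 0 0).attach i (0, 2)) =
      (Mat_.embedding (Cob R α)).map ((Quotient.functor (cobRel R α)).map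
        (α • gen R (X := ⟨.turnback, m⟩) (Y := ⟨.turnback, n⟩)
          (Cobordism.decoratedId .turnback 0 0))) := by
  unfold qHom
  congr 1
  apply CategoryTheory.Quotient.sound
  refine (CobRel.neckBubble (X := ⟨.turnback, m⟩) (Y := ⟨.turnback, n⟩)
    (Cobordism.decoratedId .turnback 0 0) i (0, 2)).trans ?_
  have h := CobRel.add (CobRel.sphereDotDot (R := R) (α := α) (X := ⟨.turnback, m⟩)
    (Y := ⟨.turnback, n⟩) ((Cobordism.decoratedId .turnback 0 0).attach i Decor.dot))
    (CobRel.sphereDotDotDot (R := R) (α := α) (X := ⟨.turnback, m⟩) (Y := ⟨.turnback, n⟩)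
      (Cobordism.decoratedId .turnback 0 0))
  rw [zero_add] at h
  exact h

theorem topDot_topDot (l m n : ℤ) :
    qHom R α l m topDot ≫ qHom R α m n topDot =
      qHom R α l m bottomDot ≫ qHom R α m n bottomDot := by
  rw [qHom_comp, qHom_comp]
  exact (qHom_twoDots R α l n .first).trans (qHom_twoDots R α l n .second).symm

theorem topDot_bottomDot (l m n : ℤ) :
    qHom R α l m topDot ≫ qHom R α m n bottomDot =
      qHom R α l m bottomDot ≫ qHom R α m n topDot := by
  rw [qHom_comp, qHom_comp]
  rfl

theorem saddle_topDot (l m n : ℤ) :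
    qHom R α l m saddle ≫ qHom R α m n topDot =
      qHom R α l m saddle ≫ qHom R α m n bottomDot := by
  rw [qHom_comp, qHom_comp]
  rfl

theorem saddle_dotMap (l m n : ℤ) : qHom R α l m saddle ≫ dotMap R α 1 m n = 0 := by
  rw [dotMap, if_pos odd_one, Preadditive.comp_sub, saddle_topDot, sub_self]

theorem dotMap_dotMap (i : ℕ) (l m n : ℤ) : dotMap R α i l m ≫ dotMap R α (i + 1) m n = 0 := by
  by_cases h : Odd i
  · rw [dotMap, dotMap, if_pos h, if_neg (by simpa [Nat.odd_add_one] using h)]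
    simp only [Preadditive.sub_comp, Preadditive.comp_add, topDot_topDot, topDot_bottomDot]
    abel
  · rw [dotMap, dotMap, if_neg h, if_pos (by simpa [Nat.odd_add_one] using h)]
    simp only [Preadditive.add_comp, Preadditive.comp_sub, topDot_topDot, topDot_bottomDot]
    abel

theorem chainD_comp (i j k : ℤ) (hij : i + 1 = j) (hjk : j + 1 = k) :
    chainD R α i j ≫ chainD R α j k = 0 := by
  subst hij hjk
  obtain (_ | n) | n := i
  · exact saddle_dotMap R α _ _ _
  · exact dotMap_dotMap R α (n + 1) _ _ _
  · exact Limits.zero_comp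

/-- The second projector, a cochain complex of formal direct sums of `q`-graded diagrams. -/
def P₂ : CochainComplex (Mat_ (Cob R α)) ℤ where
  X := chainObj R α
  d i j := if i + 1 = j then chainD R α i j else 0
  shape i j h := if_neg h
  d_comp_d' i j k hij hjk := by
    rw [if_pos (show i + 1 = j from hij), if_pos (show j + 1 = k from hjk)]
    exact chainD_comp R α i j k hij hjk

/-- The cochain `b = (left dot, top dot, top dot, ...)` of degree `0`. -/
def bCochain : Cochain (P₂ R α) (P₂ R α) 0 :=
  Cochain.mk fun p q _ =>
    (match p, q with
      | .ofNat 0, .ofNat 0 => qHom R α _ _ leftDot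
      | .ofNat (_ + 1), .ofNat (_ + 1) => qHom R α _ _ topDot
      | _, _ => 0 : chainObj R α p ⟶ chainObj R α q)

/-- The cochain `u = (saddle, identity, identity, ...)` of degree `-2`; the saddle is its component
`C_2 → C_0`. -/
def uCochain : Cochain (P₂ R α) (P₂ R α) (-2) :=
  Cochain.mk fun p q _ =>
    (match p, q with
      | .ofNat (_ + 1), .ofNat 0 => qHom R α _ _ cosaddle
      | .ofNat (_ + 1), .ofNat (_ + 1) => qHom R α _ _ turnbackId
      | _, _ => 0 : chainObj R α p ⟶ chainObj R α q)

/-- The cochain `w = (dotted saddle, top dot, top dot, ...)` of degree `-3`; the dotted saddle is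
its component `C_3 → C_0`. -/
def wCochain : Cochain (P₂ R α) (P₂ R α) (-3) :=
  Cochain.mk fun p q _ =>
    (match p, q with
      | .ofNat (_ + 1), .ofNat 0 => qHom R α _ _ dottedCosaddle
      | .ofNat (_ + 1), .ofNat (_ + 1) => qHom R α _ _ topDot
      | _, _ => 0 : chainObj R α p ⟶ chainObj R α q)

end Projector

/-! ## The homology algebra of the endomorphism dg algebra of a complex

The endomorphism dg algebra of `K` has the cochains `Cochain K K n` in degree `n`, the differential
`δ f = d ∘ f - (-1) ^ n f ∘ d`, and the composition as its product. -/

section EndHomology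

universe v u

variable {C : Type u} [Category.{v} C] [Preadditive C] (K : CochainComplex C ℤ)

/-- The product `f ∘ g` of cocycles. -/
def cocycleMul {m n : ℤ} (f : Cocycle K K m) (g : Cocycle K K n) : Cocycle K K (m + n) :=
  Cocycle.mk ((g : Cochain K K n).comp (f : Cochain K K m) (add_comm n m)) (m + n + 1) rfl (by
    rw [δ_comp _ _ (add_comm n m) (n + 1) (m + 1) (m + n + 1) rfl rfl rfl]
    simp)

theorem coe_cocycleMul {m n : ℤ} (f : Cocycle K K m) (g : Cocycle K K n) :
    (cocycleMul K f g : Cochain K K (m + n)) =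
      (g : Cochain K K n).comp (f : Cochain K K m) (add_comm n m) := rfl

theorem cocycleMul_mem_right {m n : ℤ} (f : Cocycle K K m) (g : Cocycle K K n)
    (hg : g ∈ coboundaries K K n) : cocycleMul K f g ∈ coboundaries K K (m + n) := by
  obtain ⟨l, hl, β, hβ⟩ := hg
  refine ⟨l + m, by lia, m.negOnePow • β.comp (f : Cochain K K m) rfl, ?_⟩
  rw [coe_cocycleMul, δ_units_smul, δ_comp _ _ rfl n (m + 1) (m + n) (by lia) hl rfl, hβ]
  simp [smul_smul]

theorem cocycleMul_mem_left {m n : ℤ} (f : Cocycle K K m) (g : Cocycle K K n)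
    (hf : f ∈ coboundaries K K m) : cocycleMul K f g ∈ coboundaries K K (m + n) := by
  obtain ⟨l, hl, β, hβ⟩ := hf
  refine ⟨n + l, by lia, (g : Cochain K K n).comp β rfl, ?_⟩
  rw [coe_cocycleMul, δ_comp _ _ rfl (n + 1) m (m + n) (by lia) rfl hl, hβ]
  simp

/-- The product of homology classes, `[f] * [g] = [f ∘ g]`, as a biadditive map. -/
def classMul (m n : ℤ) :
    CohomologyClass K K m →+ CohomologyClass K K n →+ CohomologyClass K K (m + n) :=
  CohomologyClass.descAddMonoidHom
    (AddMonoidHom.mk'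
      (fun f => CohomologyClass.descAddMonoidHom
        (AddMonoidHom.mk' (fun g => CohomologyClass.mk (cocycleMul K f g)) (fun g g' => by
          rw [← CohomologyClass.mk_add]
          congr 1
          ext : 1
          exact Cochain.add_comp (g : Cochain K K n) (g' : Cochain K K n)
            (f : Cochain K K m) (add_comm n m)))
        (fun g hg => (CohomologyClass.mk_eq_zero_iff _).2 (cocycleMul_mem_right K f g hg)))
      (fun f f' => by
        ext y
        obtain ⟨g, rfl⟩ := y.mk_surjective
        change CohomologyClass.mk (cocycleMul K (f + f') g) =
          CohomologyClass.mk (cocycleMul K f g) + CohomologyClass.mk (cocycleMul K f' g)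
        rw [← CohomologyClass.mk_add]
        congr 1
        ext : 1
        exact Cochain.comp_add (g : Cochain K K n) (f : Cochain K K m)
          (f' : Cochain K K m) (add_comm n m)))
    (fun f hf => by
      ext y
      obtain ⟨g, rfl⟩ := y.mk_surjective
      exact (CohomologyClass.mk_eq_zero_iff _).2 (cocycleMul_mem_left K f g hf))

theorem classMul_mk {m n : ℤ} (f : Cocycle K K m) (g : Cocycle K K n) :
    classMul K m n (CohomologyClass.mk f) (CohomologyClass.mk g) =
      CohomologyClass.mk (cocycleMul K f g) := rfl

/-- The homology class of the identity. -/
def classOne : CohomologyClass K K 0 := CohomologyClass.mk (Cocycle.ofHom (𝟙 K))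

theorem gradedMk_eq {m n : ℤ} (h : m = n) (f : Cocycle K K m) (g : Cocycle K K n)
    (hfg : ∀ p q (hm : p + m = q) (hn : p + n = q),
      (f : Cochain K K m).v p q hm = (g : Cochain K K n).v p q hn) :
    (GradedMonoid.mk m (CohomologyClass.mk f) : GradedMonoid (CohomologyClass K K)) =
      GradedMonoid.mk n (CohomologyClass.mk g) := by
  subst h
  congr 2
  ext p q hpq
  exact hfg p q hpq hpq

instance : GradedMonoid.GMul (CohomologyClass K K) where
  mul {m n} x y := classMul K m n x y

instance : GradedMonoid.GOne (CohomologyClass K K) where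
  one := classOne K

instance : DirectSum.GRing (CohomologyClass K K) where
  mul_zero _ := map_zero _
  zero_mul {m n} y := DFunLike.congr_fun (map_zero (classMul K m n)) y
  mul_add _ _ _ := map_add _ _ _
  add_mul {m n} x x' y := DFunLike.congr_fun (map_add (classMul K m n) x x') y
  one_mul := by
    rintro ⟨n, x⟩
    obtain ⟨f, rfl⟩ := x.mk_surjective
    refine gradedMk_eq K (zero_add n) _ _ fun p q hm hn => ?_
    change ((f : Cochain K K n).comp (Cochain.ofHom (𝟙 K)) (add_comm n 0)).v p q hm = _
    rw [Cochain.comp_v _ _ _ p q q hn (add_zero q)]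
    simp
  mul_one := by
    rintro ⟨n, x⟩
    obtain ⟨f, rfl⟩ := x.mk_surjective
    refine gradedMk_eq K (add_zero n) _ _ fun p q hm hn => ?_
    change ((Cochain.ofHom (𝟙 K)).comp (f : Cochain K K n) (add_comm 0 n)).v p q hm = _
    rw [Cochain.comp_v _ _ _ p p q (add_zero p) hn]
    simp
  mul_assoc := by
    rintro ⟨l, x⟩ ⟨m, y⟩ ⟨n, z⟩
    obtain ⟨f, rfl⟩ := x.mk_surjective
    obtain ⟨g, rfl⟩ := y.mk_surjective
    obtain ⟨h, rfl⟩ := z.mk_surjective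
    refine gradedMk_eq K (add_assoc l m n) _ _ fun p q hp hq => ?_
    change ((h : Cochain K K n).comp ((g : Cochain K K m).comp (f : Cochain K K l)
        (add_comm m l)) (add_comm n (l + m))).v p q hp =
      (((h : Cochain K K n).comp (g : Cochain K K m) (add_comm n m)).comp (f : Cochain K K l)
        (add_comm (m + n) l)).v p q hq
    rw [Cochain.comp_v _ _ _ p (p + n) q rfl (by lia),
      Cochain.comp_v _ _ _ (p + n) (p + n + m) q rfl (by lia),
      Cochain.comp_v _ _ (add_comm (m + n) l) p (p + n + m) q (by lia) (by lia),
      Cochain.comp_v _ _ _ p (p + n) (p + n + m) rfl rfl, Category.assoc]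
  natCast n := n • classOne K
  natCast_zero := zero_smul _ _
  natCast_succ n := succ_nsmul _ n
  intCast n := n • classOne K
  intCast_ofNat n := natCast_zsmul _ n
  intCast_negSucc_ofNat n := negSucc_zsmul _ n

/-- The homology of the endomorphism dg algebra of `K`: the direct sum of the homology groups of all
degrees, a ring under composition. -/
abbrev EndHomology := ⨁ n : ℤ, CohomologyClass K K n

/-- The homology class of a cochain which is a cocycle, that is `δ f = 0`. -/
def homologyClass {n : ℤ} (f : Cochain K K n) (hf : δ n (n + 1) f = 0) : EndHomology K :=
  DirectSum.of (CohomologyClass K K) n (CohomologyClass.mk (Cocycle.mk f (n + 1) rfl hf))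

end EndHomology

end SheetAlgebra

end

/-!
The morphisms of the cobordism category embed into one commutative ring. Cutting necks reduces every
cobordism between the two diagrams to a combination of `1, t, t', t t'` (endomorphisms, `t` and `t'`
being dots on the two sheets) or of `σ, σ t` (morphisms between the two different diagrams, `σ` being
a saddle), and gluing becomes the multiplication of
`ℤ[t, t', σ] / (t², t'², σ² - t - t', σ t - σ t')`, here called `DotRing`. The evaluation
`Cobordism.eval` respects gluing and the local relations (`Sheets.eval_comp`,
`evalLin_eq_of_cobRel`), hence it is defined on the cobordism category; it is injective there because
conversely the local relations bring every cobordism into the normal form with the same value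
(`qHom_eq_normalForm`). So a cochain of degree `k` of `End(P₂)` is a sequence of elements of `DotRing`
(`coeff`), with products and differential given by the ring structure and by the sequence
`σ, t - t', t + t', t - t', ...` of the values of the differential of `P₂`.

The complex `Hom(P₂, turnback)` is exact (`exists_dVal_mul_eq`). As cochains into the tail
`C_1 → C_2 → ...` can be treated one target after the other, starting from `C_1`, the projection
`End(P₂) → Hom(P₂, C_0)` is a quasi-isomorphism: a cocycle is a coboundary exactly if its component
with values in `C_0` is one (`mem_coboundaries_iff`). The target is the small complex
`... → ⟨σ, σ t⟩ → ⟨σ, σ t⟩ → ⟨σ, σ t⟩ → ⟨1, t, t', t t'⟩` in degrees `≤ 0`, with the multiplications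
by `..., t + t', t - t', σ` as differentials, that is by `..., 2 t, 0, σ`. Its homology is spanned by
`1, t` in degree `0`, by `σ, σ t` with `2 σ t = 0` in degree `-2 i < 0` and by `σ t` in degree
`-2 i - 3`. These are the components of `1, b`, of `u ^ i, u ^ i b` and of `u ^ i w`. All relations
between products of `u`, `w` and `b` are read off from components with values in `C_0` as well.
-/

noncomputable section

namespace SheetAlgebra

/-! ### The ring of coefficients -/

/-- The commutative ring `ℤ[t, t', σ] / (t², t'², σ² - t - t', σ t - σ t')`, by coordinates in its
basis `1, t, t', t t', σ, σ t`. Here `t` and `t'` stand for a dot on the first and on the second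
sheet, and `σ` stands for a saddle in either direction, so that `σ² = t + t'` is neck-cutting. The
endomorphisms of either diagram are the span of `1, t, t', t t'`, the morphisms between different
diagrams are the span of `σ, σ t`, and the composition is the multiplication of this ring. -/
@[ext]
structure DotRing where
  /-- The coefficient of `1`. -/
  one : ℤ
  /-- The coefficient of `t`. -/
  fst : ℤ
  /-- The coefficient of `t'`. -/
  snd : ℤ
  /-- The coefficient of `t t'`. -/
  both : ℤ
  /-- The coefficient of `σ`. -/
  sad : ℤ
  /-- The coefficient of `σ t`. -/
  dotSad : ℤ

namespace DotRing

instance : Zero DotRing := ⟨⟨0, 0, 0, 0, 0, 0⟩⟩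
instance : One DotRing := ⟨⟨1, 0, 0, 0, 0, 0⟩⟩
instance : Add DotRing := ⟨fun x y => ⟨x.one + y.one, x.fst + y.fst, x.snd + y.snd,
  x.both + y.both, x.sad + y.sad, x.dotSad + y.dotSad⟩⟩
instance : Neg DotRing := ⟨fun x => ⟨-x.one, -x.fst, -x.snd, -x.both, -x.sad, -x.dotSad⟩⟩
instance : Sub DotRing := ⟨fun x y => ⟨x.one - y.one, x.fst - y.fst, x.snd - y.snd,
  x.both - y.both, x.sad - y.sad, x.dotSad - y.dotSad⟩⟩
instance : SMul ℤ DotRing :=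
  ⟨fun n x => ⟨n * x.one, n * x.fst, n * x.snd, n * x.both, n * x.sad, n * x.dotSad⟩⟩
instance : SMul ℕ DotRing := ⟨fun n x => (n : ℤ) • x⟩
instance : IntCast DotRing := ⟨fun n => ⟨n, 0, 0, 0, 0, 0⟩⟩
instance : NatCast DotRing := ⟨fun n => ⟨n, 0, 0, 0, 0, 0⟩⟩
instance : Mul DotRing := ⟨fun x y =>
  ⟨x.one * y.one,
    x.one * y.fst + x.fst * y.one + x.sad * y.sad,
    x.one * y.snd + x.snd * y.one + x.sad * y.sad,
    x.one * y.both + x.both * y.one + x.fst * y.snd + x.snd * y.fst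
      + x.sad * y.dotSad + x.dotSad * y.sad,
    x.one * y.sad + x.sad * y.one,
    x.one * y.dotSad + x.dotSad * y.one + (x.fst + x.snd) * y.sad + x.sad * (y.fst + y.snd)⟩⟩

theorem zero_def : (0 : DotRing) = ⟨0, 0, 0, 0, 0, 0⟩ := rfl
theorem one_def : (1 : DotRing) = ⟨1, 0, 0, 0, 0, 0⟩ := rfl
theorem intCast_def (n : ℤ) : (n : DotRing) = ⟨n, 0, 0, 0, 0, 0⟩ := rfl
theorem add_def (x y : DotRing) : x + y = ⟨x.one + y.one, x.fst + y.fst, x.snd + y.snd,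
  x.both + y.both, x.sad + y.sad, x.dotSad + y.dotSad⟩ := rfl
theorem sub_def (x y : DotRing) : x - y = ⟨x.one - y.one, x.fst - y.fst, x.snd - y.snd,
  x.both - y.both, x.sad - y.sad, x.dotSad - y.dotSad⟩ := rfl
theorem neg_def (x : DotRing) :
    -x = ⟨-x.one, -x.fst, -x.snd, -x.both, -x.sad, -x.dotSad⟩ := rfl
theorem zsmul_def (n : ℤ) (x : DotRing) : n • x =
  ⟨n * x.one, n * x.fst, n * x.snd, n * x.both, n * x.sad, n * x.dotSad⟩ := rfl
theorem mul_def (x y : DotRing) : x * y =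
  ⟨x.one * y.one,
    x.one * y.fst + x.fst * y.one + x.sad * y.sad,
    x.one * y.snd + x.snd * y.one + x.sad * y.sad,
    x.one * y.both + x.both * y.one + x.fst * y.snd + x.snd * y.fst
      + x.sad * y.dotSad + x.dotSad * y.sad,
    x.one * y.sad + x.sad * y.one,
    x.one * y.dotSad + x.dotSad * y.one + (x.fst + x.snd) * y.sad + x.sad * (y.fst + y.snd)⟩ := rfl

instance : CommRing DotRing where
  add_assoc x y z := by simp only [add_def, add_assoc]
  zero_add x := by simp only [add_def, zero_def, zero_add]
  add_zero x := by simp only [add_def, zero_def, add_zero]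
  add_comm x y := by simp only [add_def, add_comm]
  nsmul n x := n • x
  nsmul_zero x := by
    change ((0 : ℕ) : ℤ) • x = 0
    simp [zsmul_def, zero_def]
  nsmul_succ n x := by
    change ((n + 1 : ℕ) : ℤ) • x = (n : ℤ) • x + x
    simp only [zsmul_def, add_def, Nat.cast_add, Nat.cast_one, add_mul, one_mul]
  zsmul n x := n • x
  zsmul_zero' x := by simp [zsmul_def, zero_def]
  zsmul_succ' n x := by
    simp only [zsmul_def, add_def, Nat.cast_succ, add_mul, one_mul]
  zsmul_neg' n x := by
    simp only [zsmul_def, neg_def, Int.negSucc_eq, Nat.cast_succ, neg_mul]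
  neg_add_cancel x := by simp only [add_def, neg_def, zero_def, neg_add_cancel]
  sub_eq_add_neg x y := by simp only [sub_def, add_def, neg_def, sub_eq_add_neg]
  zero_mul x := by simp [mul_def, zero_def]
  mul_zero x := by simp [mul_def, zero_def]
  one_mul x := by simp [mul_def, one_def]
  mul_one x := by simp [mul_def, one_def]
  mul_comm x y := by ext <;> simp only [mul_def] <;> ring
  mul_assoc x y z := by ext <;> simp only [mul_def] <;> ring
  left_distrib x y z := by ext <;> simp only [mul_def, add_def] <;> ring
  right_distrib x y z := by ext <;> simp only [mul_def, add_def] <;> ring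
  natCast_zero := rfl
  natCast_succ n := by
    change (⟨((n + 1 : ℕ) : ℤ), 0, 0, 0, 0, 0⟩ : DotRing) = ⟨(n : ℤ), 0, 0, 0, 0, 0⟩ + 1
    simp [one_def, add_def]
  intCast_ofNat n := rfl
  intCast_negSucc n := by
    change (⟨Int.negSucc n, 0, 0, 0, 0, 0⟩ : DotRing) = -⟨((n + 1 : ℕ) : ℤ), 0, 0, 0, 0, 0⟩
    simp [neg_def, Int.negSucc_eq]

/-- A dot on the first sheet. -/
def t : DotRing := ⟨0, 1, 0, 0, 0, 0⟩

/-- A dot on the second sheet. -/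
def t' : DotRing := ⟨0, 0, 1, 0, 0, 0⟩

/-- A saddle. -/
def σ : DotRing := ⟨0, 0, 0, 0, 1, 0⟩

@[simp] theorem t_mul_t : t * t = 0 := rfl
@[simp] theorem t'_mul_t' : t' * t' = 0 := rfl
theorem σ_mul_σ : σ * σ = t + t' := rfl
theorem t'_mul_σ : t' * σ = t * σ := rfl

end DotRing

/-! ### Evaluation of cobordisms -/

namespace DotRing

/-- The value `(2 y) ^ g * y ^ n` of a component of genus `g` with `n` dots, where `y` is the value
of a dot: by neck-cutting a handle is worth two dots. -/
def decor (y : DotRing) (p : Decor) : DotRing := (2 * y) ^ p.1 * y ^ p.2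

theorem decor_add (y : DotRing) (p q : Decor) : decor y (p + q) = decor y p * decor y q := by
  simp only [decor, Prod.fst_add, Prod.snd_add, pow_add]
  ring

@[simp] theorem decor_zero (y : DotRing) : decor y 0 = 1 := by simp [decor]

@[simp] theorem decor_dot (y : DotRing) : decor y Decor.dot = y := by simp [decor, Decor.dot]

@[simp] theorem decor_handle (y : DotRing) : decor y Decor.handle = 2 * y := by
  simp [decor, Decor.handle]

theorem decor_mul_eq_of_mul_eq {y y' z : DotRing} (h : y' * z = y * z) (p : Decor) :
    decor y' p * z = decor y p * z := by
  have key (n : ℕ) : y' ^ n * z = y ^ n * z := by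
    induction n with
    | zero => simp
    | succ n ih => rw [pow_succ', mul_assoc, ih, mul_left_comm, h, pow_succ]; ring
  obtain ⟨g, n⟩ := p
  simp only [decor, mul_pow]
  calc 2 ^ g * y' ^ g * y' ^ n * z = 2 ^ g * (y' ^ (g + n) * z) := by ring
    _ = 2 ^ g * y ^ g * y ^ n * z := by rw [key]; ring

end DotRing

open DotRing

/-- The value of a closed component of genus `p.1` with `p.2` dots: the coefficient of `x` in
`(2 x) ^ p.1 * x ^ p.2`, where `x ^ 2 = 0`. -/
def closedVal (p : Decor) : ℤ := if p.1 + p.2 = 1 then 2 ^ p.1 else 0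

theorem closedVal_of_two_le (p : Decor) (h : 2 ≤ p.1 + p.2) : closedVal p = 0 :=
  if_neg (by lia)

theorem closedVal_add_handle (p : Decor) :
    closedVal (p + Decor.handle) = closedVal (p + Decor.dot) + closedVal (p + Decor.dot) := by
  obtain ⟨g, n⟩ := p
  by_cases h : g + n = 0
  · obtain ⟨rfl, rfl⟩ : g = 0 ∧ n = 0 := by lia
    rfl
  · simp only [Decor.handle, Decor.dot, Prod.mk_add_mk]
    rw [closedVal_of_two_le _ (by simp; lia), closedVal_of_two_le _ (by simp; lia)]
    rfl

/-- Cutting off the decorations of a component as a closed surface. -/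
theorem DotRing.decor_eq {y : DotRing} (hy : y * y = 0) (p : Decor) :
    decor y p = closedVal p * y + closedVal (p + Decor.dot) := by
  have hy2 : y ^ 2 = 0 := by rw [pow_two, hy]
  obtain ⟨g, n⟩ := p
  by_cases h : 2 ≤ g + n
  · rw [closedVal_of_two_le _ h, closedVal_of_two_le _ (by simp [Decor.dot]; lia), decor,
      mul_pow, mul_assoc, ← pow_add, pow_eq_zero_of_le h hy2]
    simp
  · obtain ⟨rfl, rfl⟩ | ⟨rfl, rfl⟩ | ⟨rfl, rfl⟩ :
        (g = 0 ∧ n = 0) ∨ (g = 1 ∧ n = 0) ∨ (g = 0 ∧ n = 1) := by lia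
    all_goals simp [decor, closedVal, Decor.dot]

theorem closedVal_add (p q : Decor) : closedVal (p + q) =
    closedVal (p + Decor.dot) * closedVal q + closedVal p * closedVal (q + Decor.dot) := by
  have h := decor_add t p q
  rw [decor_eq rfl, decor_eq rfl, decor_eq rfl] at h
  have h' := congrArg DotRing.fst h
  simp only [add_def, mul_def, intCast_def, t] at h'
  linarith

/-- The value of the components which meet the boundary. A tube is worth `t + t'`, by
neck-cutting. -/
def Sheets.eval : {A B : Diagram} → Sheets A B → DotRing
  | _, _, .pair _ p q => decor t p * decor t' q
  | _, _, .tube _ p => decor t p * (t + t')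
  | _, _, .saddle p => decor t p * σ
  | _, _, .cosaddle p => decor t p * σ

theorem decor_t'_mul_σ (p : Decor) : decor t' p * σ = decor t p * σ :=
  decor_mul_eq_of_mul_eq t'_mul_σ p

theorem decor_t'_mul_tube (p : Decor) : decor t' p * (t + t') = decor t p * (t + t') :=
  decor_mul_eq_of_mul_eq (y := t) (y' := t') rfl p

theorem two_mul_t_mul_tube : 2 * t * (t + t') = (t + t') * (t + t') := rfl

theorem two_mul_t_mul_σ : 2 * t * σ = (t + t') * σ := rfl

theorem Sheets.eval_comp {A B C : Diagram} (S : Sheets A B) (T : Sheets B C) :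
    (S.comp T).eval = S.eval * T.eval := by
  cases S <;> cases T <;>
    simp only [Sheets.comp, Sheets.eval, decor_add, decor_handle]
  case pair.pair => ring
  case pair.tube p q r =>
    linear_combination (-decor t p * decor t r) * decor_t'_mul_tube q
  case tube.pair r p q =>
    linear_combination (-decor t p * decor t r) * decor_t'_mul_tube q
  case tube.tube p q =>
    linear_combination (decor t p * decor t q) * two_mul_t_mul_tube
  case pair.saddle p q r => linear_combination (-decor t p * decor t r) * decor_t'_mul_σ q
  case saddle.pair r p q => linear_combination (-decor t p * decor t r) * decor_t'_mul_σ q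
  case pair.cosaddle p q r => linear_combination (-decor t p * decor t r) * decor_t'_mul_σ q
  case cosaddle.pair r p q => linear_combination (-decor t p * decor t r) * decor_t'_mul_σ q
  case tube.saddle p q => linear_combination (decor t p * decor t q) * two_mul_t_mul_σ
  case tube.cosaddle p q => linear_combination (decor t p * decor t q) * two_mul_t_mul_σ
  case saddle.tube p q => linear_combination (decor t p * decor t q) * two_mul_t_mul_σ
  case cosaddle.tube p q => linear_combination (decor t p * decor t q) * two_mul_t_mul_σ
  case saddle.cosaddle p q => linear_combination (-decor t p * decor t q) * σ_mul_σ
  case cosaddle.saddle p q => linear_combination (-decor t p * decor t q) * σ_mul_σ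

/-- The value of a dot on the component through the given arc of the source. -/
def arcDot : Arc → DotRing
  | .first => t
  | .second => t'

theorem arcDot_mul_self (i : Arc) : arcDot i * arcDot i = 0 := by cases i <;> rfl

theorem Sheets.eval_attach {A B : Diagram} (S : Sheets A B) (i : Arc) (p : Decor) :
    (S.attach i p).eval = S.eval * decor (arcDot i) p := by
  cases S <;> cases i <;> simp only [Sheets.attach, Sheets.eval, decor_add, arcDot]
  case pair.first | pair.second => ring
  case tube.first | saddle.first | cosaddle.first => ring
  case tube.second q => linear_combination -decor t q * decor_t'_mul_tube p
  case saddle.second q => linear_combination -decor t q * decor_t'_mul_σ p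
  case cosaddle.second q => linear_combination -decor t q * decor_t'_mul_σ p

/-- The value of a dotted cobordism. -/
def Cobordism.eval {A B : Diagram} (S : Cobordism A B) : DotRing :=
  ((S.closed.map closedVal).prod : ℤ) * S.sheets.eval

theorem Cobordism.eval_addClosed {A B : Diagram} (S : Cobordism A B) (p : Decor) :
    (S.addClosed p).eval = closedVal p * S.eval := by
  simp [Cobordism.eval, Cobordism.addClosed, mul_assoc]

theorem Cobordism.eval_attach {A B : Diagram} (S : Cobordism A B) (i : Arc) (p : Decor) :
    (S.attach i p).eval = S.eval * decor (arcDot i) p := by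
  simp [Cobordism.eval, Cobordism.attach, Sheets.eval_attach, mul_assoc]

/-- The evaluation of cobordisms as a functor. -/
def evalFunctor : QDiagram ⥤ SingleObj DotRing where
  obj _ := SingleObj.star DotRing
  map S := Cobordism.eval S
  map_id X := by
    change Cobordism.eval (Cobordism.decoratedId X.diagram 0 0) = 1
    simp [Cobordism.eval, Cobordism.decoratedId, Sheets.eval]
  map_comp S T := by
    change Cobordism.eval ⟨S.sheets.comp T.sheets, S.closed + T.closed⟩ =
      Cobordism.eval T * Cobordism.eval S
    simp only [Cobordism.eval, Sheets.eval_comp, Multiset.map_add, Multiset.prod_add]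
    push_cast
    ring

/-- The linear extension of the evaluation to linear combinations of cobordisms. -/
def evalLin {X Y : Free ℤ QDiagram} (f : X ⟶ Y) : DotRing := (Free.lift ℤ evalFunctor).map f

theorem evalLin_gen {X Y : QDiagram} (S : Cobordism X.diagram Y.diagram) :
    evalLin (gen ℤ (X := X) (Y := Y) S) = S.eval :=
  (Free.lift_map_single ℤ evalFunctor (X := X) (Y := Y) S 1).trans (one_smul ℤ _)

theorem evalLin_add {X Y : Free ℤ QDiagram} (f g : X ⟶ Y) :
    evalLin (f + g) = evalLin f + evalLin g := (Free.lift ℤ evalFunctor).map_add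

theorem evalLin_smul {X Y : Free ℤ QDiagram} (c : ℤ) (f : X ⟶ Y) :
    evalLin (c • f) = c • evalLin f := (Free.lift ℤ evalFunctor).map_smul c f

theorem evalLin_zero {X Y : Free ℤ QDiagram} : evalLin (0 : X ⟶ Y) = 0 :=
  (Free.lift ℤ evalFunctor).map_zero _ _

theorem evalLin_comp {X Y Z : Free ℤ QDiagram} (f : X ⟶ Y) (g : Y ⟶ Z) :
    evalLin (f ≫ g) = evalLin f * evalLin g :=
  ((Free.lift ℤ evalFunctor).map_comp f g).trans (mul_comm (evalLin g) (evalLin f))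

theorem evalLin_eq_of_cobRel {X Y : Free ℤ QDiagram} {f g : X ⟶ Y} (h : CobRel ℤ 0 f g) :
    evalLin f = evalLin g := by
  induction h with
  | sphere S => simp [evalLin_gen, evalLin_zero, Cobordism.eval_addClosed, closedVal]
  | sphereDot S => simp [evalLin_gen, Cobordism.eval_addClosed, closedVal]
  | sphereDotDot S => simp [evalLin_gen, evalLin_zero, Cobordism.eval_addClosed, closedVal]
  | sphereDotDotDot S =>
    simp [evalLin_gen, evalLin_zero, Cobordism.eval_addClosed, closedVal]
  | neckHandle S i =>
    simp only [evalLin_add, evalLin_gen, Cobordism.eval_attach, decor_handle, decor_dot]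
    ring
  | neckBubble S i p =>
    simp only [evalLin_add, evalLin_gen, Cobordism.eval_attach, Cobordism.eval_addClosed, decor_dot,
      decor_eq (arcDot_mul_self i) p]
    ring
  | neckTube A m n p q c =>
    simp only [evalLin_add, evalLin_gen, Cobordism.eval, Sheets.eval, decor_add, decor_dot]
    linear_combination (-((c.map closedVal).prod : ℤ) * decor t p) * decor_t'_mul_tube q
  | neckClosedHandle S p =>
    simp only [evalLin_add, evalLin_gen, Cobordism.eval_addClosed, closedVal_add_handle]
    push_cast
    ring
  | neckClosed S p q =>
    simp only [evalLin_add, evalLin_gen, Cobordism.eval_addClosed]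
    rw [closedVal_add p q]
    push_cast
    ring
  | refl => rfl
  | symm _ h => exact h.symm
  | trans _ _ h h' => exact h.trans h'
  | add _ _ h h' => rw [evalLin_add, evalLin_add, h, h']
  | smul c _ h => rw [evalLin_smul, evalLin_smul, h]
  | comp _ _ h h' => rw [evalLin_comp, evalLin_comp, h, h']

/-- The evaluation of morphisms of the cobordism category. -/
def evalCob {X Y : Cob ℤ 0} : (X ⟶ Y) →+ DotRing where
  toFun f := (CategoryTheory.Quotient.lift (cobRel ℤ 0) (Free.lift ℤ evalFunctor)
    (fun _ _ _ _ h => evalLin_eq_of_cobRel h)).map f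
  map_zero' := evalLin_zero (X := X.as) (Y := Y.as)
  map_add' f g := by
    obtain ⟨f, rfl⟩ := (CategoryTheory.Quotient.functor (cobRel ℤ 0)).map_surjective f
    obtain ⟨g, rfl⟩ := (CategoryTheory.Quotient.functor (cobRel ℤ 0)).map_surjective g
    exact evalLin_add f g

theorem evalCob_comp {X Y Z : Cob ℤ 0} (f : X ⟶ Y) (g : Y ⟶ Z) :
    evalCob (f ≫ g) = evalCob f * evalCob g :=
  ((CategoryTheory.Quotient.lift (cobRel ℤ 0) (Free.lift ℤ evalFunctor)
    (fun _ _ _ _ h => evalLin_eq_of_cobRel h)).map_comp f g).trans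
    (mul_comm (evalCob g) (evalCob f))

/-! ### Morphisms between diagrams in coordinates -/

open DotRing

section NormalForm

variable {A B C : Diagram} {l m n : ℤ}

/-- The morphism of one-term formal direct sums given by a linear combination of cobordisms. -/
def qMap (f : Free.of ℤ (⟨A, m⟩ : QDiagram) ⟶ Free.of ℤ (⟨B, n⟩ : QDiagram)) :
    qObj ℤ 0 A m ⟶ qObj ℤ 0 B n :=
  (Mat_.embedding (Cob ℤ 0)).map ((CategoryTheory.Quotient.functor (cobRel ℤ 0)).map f)

theorem qMap_add (f g : Free.of ℤ (⟨A, m⟩ : QDiagram) ⟶ Free.of ℤ (⟨B, n⟩ : QDiagram)) :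
    qMap (f + g) = qMap f + qMap g := rfl

theorem qMap_gen (S : Cobordism A B) :
    qMap (gen ℤ (X := ⟨A, m⟩) (Y := ⟨B, n⟩) S) = qHom ℤ 0 m n S := rfl

theorem qMap_eq_of_cobRel {f g : Free.of ℤ (⟨A, m⟩ : QDiagram) ⟶ Free.of ℤ (⟨B, n⟩ : QDiagram)}
    (h : CobRel ℤ 0 f g) : qMap f = qMap g :=
  congrArg (Mat_.embedding (Cob ℤ 0)).map (CategoryTheory.Quotient.sound (cobRel ℤ 0) h)

theorem qMap_surjective : Function.Surjective (qMap (A := A) (B := B) (m := m) (n := n)) := by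
  intro f
  obtain ⟨g, hg⟩ := (CategoryTheory.Quotient.functor (cobRel ℤ 0)).map_surjective
    (X := Free.of ℤ (⟨A, m⟩ : QDiagram)) (Y := Free.of ℤ (⟨B, n⟩ : QDiagram)) (f ⟨⟩ ⟨⟩)
  refine ⟨g, ?_⟩
  ext ⟨⟩ ⟨⟩
  exact hg

/-- Closed components can be removed. -/
theorem qHom_addClosed (S : Cobordism A B) (p : Decor) :
    qHom ℤ 0 m n (S.addClosed p) = closedVal p • qHom ℤ 0 m n S := by
  obtain ⟨g, k⟩ := p
  induction g generalizing k with
  | succ g ih =>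
    have h := qMap_eq_of_cobRel (CobRel.neckClosedHandle (R := ℤ) (α := 0) (X := ⟨A, m⟩)
      (Y := ⟨B, n⟩) S (g, k))
    rw [qMap_add, qMap_gen, qMap_gen] at h
    rw [show ((g + 1, k) : Decor) = (g, k) + Decor.handle from rfl, h, closedVal_add_handle,
      add_smul]
    exact congrArg₂ (· + ·) (ih (k + 1)) (ih (k + 1))
  | zero =>
    match k with
    | 0 =>
      exact (qMap_eq_of_cobRel (CobRel.sphere (R := ℤ) (α := 0) (X := ⟨A, m⟩) (Y := ⟨B, n⟩)
        S)).trans (zero_smul ℤ (qHom ℤ 0 m n S)).symm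
    | 1 =>
      exact (qMap_eq_of_cobRel (CobRel.sphereDot (R := ℤ) (α := 0) (X := ⟨A, m⟩) (Y := ⟨B, n⟩)
        S)).trans (one_smul ℤ (qHom ℤ 0 m n S)).symm
    -- A sphere with `k + 2` dots is cut into pieces one of which has two or three dots.
    | k + 2 =>
      have h := (CobRel.neckClosed (R := ℤ) (α := 0) (X := ⟨A, m⟩) (Y := ⟨B, n⟩) S
        (0, k) (0, 2)).trans (CobRel.add (CobRel.sphereDotDot _) (CobRel.sphereDotDotDot _))
      rw [zero_smul, add_zero] at h
      rw [closedVal_of_two_le _ (by simp), zero_smul]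
      exact (congrArg (fun p => qHom ℤ 0 m n (S.addClosed p)) (by simp)).trans
        (qMap_eq_of_cobRel h)

theorem qHom_attach (S : Cobordism A B) (i : Arc) (p : Decor) :
    qHom ℤ 0 m n (S.attach i p) = closedVal p • qHom ℤ 0 m n (S.attach i Decor.dot)
      + closedVal (p + Decor.dot) • qHom ℤ 0 m n S := by
  have h := qMap_eq_of_cobRel (CobRel.neckBubble (R := ℤ) (α := 0) (X := ⟨A, m⟩) (Y := ⟨B, n⟩)
    S i p)
  rw [qMap_add, qMap_gen, qMap_gen, qMap_gen, qHom_addClosed, qHom_addClosed] at h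
  exact h

theorem qHom_eq_closedVal_smul (S : Sheets A B) (c : Multiset Decor) :
    qHom ℤ 0 m n ⟨S, c⟩ = (c.map closedVal).prod • qHom ℤ 0 m n ⟨S, 0⟩ := by
  induction c using Multiset.induction_on with
  | empty => simp
  | cons p c ih =>
    refine (qHom_addClosed ⟨S, c⟩ p).trans ?_
    rw [ih, smul_smul, Multiset.map_cons, Multiset.prod_cons]

/-- The morphism with given coordinates. The coordinates `sad` and `dotSad` are discarded for
endomorphisms, the other ones for morphisms between different diagrams. -/
def normalForm : (A B : Diagram) → (m n : ℤ) → DotRing → (qObj ℤ 0 A m ⟶ qObj ℤ 0 B n)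
  | .straight, .turnback, m, n, x => x.sad • qHom ℤ 0 m n ⟨.saddle 0, 0⟩
      + x.dotSad • qHom ℤ 0 m n ⟨.saddle Decor.dot, 0⟩
  | .turnback, .straight, m, n, x => x.sad • qHom ℤ 0 m n ⟨.cosaddle 0, 0⟩
      + x.dotSad • qHom ℤ 0 m n ⟨.cosaddle Decor.dot, 0⟩
  | .straight, .straight, m, n, x => x.one • qHom ℤ 0 m n (.decoratedId _ 0 0)
      + x.fst • qHom ℤ 0 m n (.decoratedId _ Decor.dot 0)
      + x.snd • qHom ℤ 0 m n (.decoratedId _ 0 Decor.dot)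
      + x.both • qHom ℤ 0 m n (.decoratedId _ Decor.dot Decor.dot)
  | .turnback, .turnback, m, n, x => x.one • qHom ℤ 0 m n (.decoratedId _ 0 0)
      + x.fst • qHom ℤ 0 m n (.decoratedId _ Decor.dot 0)
      + x.snd • qHom ℤ 0 m n (.decoratedId _ 0 Decor.dot)
      + x.both • qHom ℤ 0 m n (.decoratedId _ Decor.dot Decor.dot)

theorem normalForm_add (x y : DotRing) :
    normalForm A B m n (x + y) = normalForm A B m n x + normalForm A B m n y := by
  cases A <;> cases B <;> simp only [normalForm, add_def, add_smul] <;> abel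

theorem normalForm_zsmul (k : ℤ) (x : DotRing) :
    normalForm A B m n (k • x) = k • normalForm A B m n x := by
  cases A <;> cases B <;> simp only [normalForm, zsmul_def, mul_smul, smul_add]

theorem normalForm_self (x : DotRing) :
    normalForm A A m n x = x.one • qHom ℤ 0 m n (.decoratedId A 0 0)
      + x.fst • qHom ℤ 0 m n (.decoratedId A Decor.dot 0)
      + x.snd • qHom ℤ 0 m n (.decoratedId A 0 Decor.dot)
      + x.both • qHom ℤ 0 m n (.decoratedId A Decor.dot Decor.dot) := by
  cases A <;> rfl

theorem qHom_pair (p q : Decor) :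
    qHom ℤ 0 m n ⟨.pair A p q, 0⟩ = normalForm A A m n (decor t p * decor t' q) := by
  have h : (⟨.pair A p q, 0⟩ : Cobordism A A) =
      ((Cobordism.decoratedId A 0 0).attach .first p).attach .second q := by
    simp [Cobordism.decoratedId, Cobordism.attach, Sheets.attach]
  have h' : ((Cobordism.decoratedId A 0 0).attach .first p).attach .second Decor.dot =
      ((Cobordism.decoratedId A 0 0).attach .second Decor.dot).attach .first p := rfl
  have h1 : ((Cobordism.decoratedId A 0 0).attach .second Decor.dot).attach .first Decor.dot =
      .decoratedId A Decor.dot Decor.dot := rfl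
  have h2 : (Cobordism.decoratedId A 0 0).attach .second Decor.dot =
      .decoratedId A 0 Decor.dot := rfl
  have h3 : (Cobordism.decoratedId A 0 0).attach .first Decor.dot =
      .decoratedId A Decor.dot 0 := rfl
  rw [h, qHom_attach, h', qHom_attach, qHom_attach (.decoratedId A 0 0) .first, h1, h2, h3,
    normalForm_self, decor_eq t_mul_t, decor_eq t'_mul_t']
  simp only [mul_def, add_def, intCast_def, t, t', mul_zero, zero_mul, add_zero, zero_add, mul_one,
    smul_add, smul_smul]
  rw [mul_comm (closedVal q) (closedVal p), mul_comm (closedVal q) (closedVal (p + _)),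
    mul_comm (closedVal (q + _)) (closedVal p),
    mul_comm (closedVal (q + _)) (closedVal (p + _))]
  abel

/-- Every cobordism is brought into normal form by the local relations. -/
theorem qHom_eq_normalForm (S : Cobordism A B) :
    qHom ℤ 0 m n S = normalForm A B m n S.eval := by
  obtain ⟨S, c⟩ := S
  rw [qHom_eq_closedVal_smul, Cobordism.eval, ← zsmul_eq_mul, normalForm_zsmul]
  congr 1
  cases S with
  | pair A p q => exact qHom_pair p q
  | tube A p =>
    have h := qMap_eq_of_cobRel (CobRel.neckTube (R := ℤ) (α := 0) A m n p 0 0)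
    rw [qMap_add, qMap_gen, qMap_gen, qMap_gen, qHom_pair, qHom_pair, ← normalForm_add,
      add_zero] at h
    refine h.trans (congrArg _ ?_)
    simp only [Sheets.eval, decor_add, decor_zero, decor_dot]
    ring
  | saddle p =>
    have h := qHom_attach (m := m) (n := n) ⟨.saddle 0, 0⟩ .first p
    simp only [Cobordism.attach, Sheets.attach, zero_add] at h
    rw [h, Sheets.eval, decor_eq t_mul_t, normalForm]
    simp [mul_def, add_def, intCast_def, t, σ, add_comm]
  | cosaddle p =>
    have h := qHom_attach (m := m) (n := n) ⟨.cosaddle 0, 0⟩ .first p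
    simp only [Cobordism.attach, Sheets.attach, zero_add] at h
    rw [h, Sheets.eval, decor_eq t_mul_t, normalForm]
    simp [mul_def, add_def, intCast_def, t, σ, add_comm]

/-- The sum of the values of the entries of a matrix of morphisms. All matrices considered below have
at most one entry, so that this is the value of this entry, or zero. -/
def evalMat {M N : Mat_ (Cob ℤ 0)} : (M ⟶ N) →+ DotRing where
  toFun f := ∑ i : M.ι, ∑ j : N.ι, evalCob (f i j)
  map_zero' := by
    refine Finset.sum_eq_zero fun i _ => Finset.sum_eq_zero fun j _ => ?_
    exact map_zero evalCob
  map_add' f g := by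
    simp only [Mat_.add_apply, map_add, Finset.sum_add_distrib]

theorem evalMat_comp {M N K : Mat_ (Cob ℤ 0)} [Subsingleton N.ι] (f : M ⟶ N) (g : N ⟶ K) :
    evalMat (f ≫ g) = evalMat f * evalMat g := by
  change ∑ i : M.ι, ∑ k : K.ι, evalCob ((f ≫ g) i k) =
    (∑ i : M.ι, ∑ j : N.ι, evalCob (f i j)) * ∑ j : N.ι, ∑ k : K.ι, evalCob (g j k)
  simp only [Mat_.comp_apply, map_sum, evalCob_comp]
  rcases isEmpty_or_nonempty N.ι with h | ⟨⟨j⟩⟩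
  · simp
  · have : Unique N.ι := ⟨⟨j⟩, fun _ => Subsingleton.elim _ _⟩
    simp only [Fintype.sum_subsingleton _ j, Finset.sum_mul, Finset.mul_sum]
    exact Finset.sum_comm

theorem evalMat_qMap (f : Free.of ℤ (⟨A, m⟩ : QDiagram) ⟶ Free.of ℤ (⟨B, n⟩ : QDiagram)) :
    evalMat (qMap f) = evalLin f := by
  change ∑ _ : PUnit, ∑ _ : PUnit, _ = _
  simp only [Finset.univ_unique, Finset.sum_singleton]
  rfl

theorem evalMat_qHom (S : Cobordism A B) : evalMat (qHom ℤ 0 m n S) = S.eval :=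
  (evalMat_qMap _).trans (evalLin_gen (X := ⟨A, m⟩) (Y := ⟨B, n⟩) S)

theorem normalForm_evalMat (f : qObj ℤ 0 A m ⟶ qObj ℤ 0 B n) :
    normalForm A B m n (evalMat f) = f := by
  obtain ⟨f, rfl⟩ := qMap_surjective f
  rw [evalMat_qMap]
  refine Finsupp.induction_linear (motive := fun f => normalForm A B m n (evalLin f) = qMap f) f
    ?_ (fun f g hf hg => ?_) fun (S : Cobordism A B) k => ?_
  · have h := normalForm_zsmul (A := A) (B := B) (m := m) (n := n) 0 0
    rw [zero_smul, zero_smul] at h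
    exact (congrArg _ evalLin_zero).trans h
  · exact (congrArg _ (evalLin_add f g)).trans ((normalForm_add _ _).trans
      (congrArg₂ (· + ·) hf hg))
  · have h : Finsupp.single S k = k • gen ℤ (X := ⟨A, m⟩) (Y := ⟨B, n⟩) S :=
      (Finsupp.smul_single_one S k).symm
    have h' : qMap (k • gen ℤ (X := ⟨A, m⟩) (Y := ⟨B, n⟩) S) = k • qHom ℤ 0 m n S :=
      map_zsmul (AddMonoidHom.mk' qMap qMap_add) k _
    have h'' : normalForm A B m n (evalLin (k • gen ℤ (X := ⟨A, m⟩) (Y := ⟨B, n⟩) S)) =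
        k • qHom ℤ 0 m n S := by
      rw [evalLin_smul, evalLin_gen, normalForm_zsmul, ← qHom_eq_normalForm]
    exact (congrArg (fun f => normalForm A B m n (evalLin f)) h).trans
      (h''.trans (h'.symm.trans (congrArg qMap h).symm))

theorem evalMat_normalForm (x : DotRing) : evalMat (normalForm A B m n x) =
    match A, B with
    | .straight, .straight | .turnback, .turnback => ⟨x.one, x.fst, x.snd, x.both, 0, 0⟩
    | .straight, .turnback | .turnback, .straight => ⟨0, 0, 0, 0, x.sad, x.dotSad⟩ := by
  cases A <;> cases B <;>
    simp only [normalForm, map_add, map_zsmul, evalMat_qHom] <;> ext <;>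
    simp [-zsmul_eq_mul, Cobordism.eval, Cobordism.decoratedId, Sheets.eval, zsmul_def, add_def,
      one_def, mul_def, t, t', σ]

end NormalForm

/-! ### Cochains in coordinates -/

open DotRing

instance (p : ℤ) : Subsingleton (chainObj ℤ 0 p).ι :=
  match p with
  | .ofNat 0 => inferInstanceAs (Subsingleton PUnit)
  | .ofNat (_ + 1) => inferInstanceAs (Subsingleton PUnit)
  | .negSucc _ => inferInstanceAs (Subsingleton PEmpty)

theorem chainHom_eq_zero_of_neg {p q : ℤ} (h : p < 0 ∨ q < 0)
    (f : chainObj ℤ 0 p ⟶ chainObj ℤ 0 q) : f = 0 := by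
  rcases h with h | h
  · obtain ⟨n, rfl⟩ := Int.eq_negSucc_of_lt_zero h
    ext i
    exact i.elim
  · obtain ⟨n, rfl⟩ := Int.eq_negSucc_of_lt_zero h
    ext _ j
    exact j.elim

theorem evalMat_injective (p q : ℤ) :
    Function.Injective (evalMat (M := chainObj ℤ 0 p) (N := chainObj ℤ 0 q)) := by
  intro f g h
  match p, q with
  | .negSucc _, _ => rw [chainHom_eq_zero_of_neg (.inl (Int.negSucc_lt_zero _)) f,
      chainHom_eq_zero_of_neg (.inl (Int.negSucc_lt_zero _)) g]
  | _, .negSucc _ => rw [chainHom_eq_zero_of_neg (.inr (Int.negSucc_lt_zero _)) f,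
      chainHom_eq_zero_of_neg (.inr (Int.negSucc_lt_zero _)) g]
  | .ofNat 0, .ofNat 0 | .ofNat 0, .ofNat (_ + 1) | .ofNat (_ + 1), .ofNat 0
  | .ofNat (_ + 1), .ofNat (_ + 1) =>
    exact (normalForm_evalMat f).symm.trans ((congrArg _ h).trans (normalForm_evalMat g))

/-- The values of the morphisms `C_p → C_q` between the chain groups of the second projector. -/
def amplitudes (p q : ℤ) : AddSubgroup DotRing :=
  (evalMat (M := chainObj ℤ 0 p) (N := chainObj ℤ 0 q)).range

theorem mul_mem_amplitudes {p q r : ℤ} {x y : DotRing} (hx : x ∈ amplitudes p q)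
    (hy : y ∈ amplitudes q r) : x * y ∈ amplitudes p r := by
  obtain ⟨f, rfl⟩ := hx
  obtain ⟨g, rfl⟩ := hy
  exact ⟨f ≫ g, evalMat_comp f g⟩

theorem eq_zero_of_mem_amplitudes {p q : ℤ} (h : p < 0 ∨ q < 0) {x : DotRing}
    (hx : x ∈ amplitudes p q) : x = 0 := by
  obtain ⟨f, rfl⟩ := hx
  rw [chainHom_eq_zero_of_neg h f, map_zero]

theorem mem_amplitudes_self {A : Diagram} {m n : ℤ} (x : DotRing) :
    x ∈ (evalMat (M := qObj ℤ 0 A m) (N := qObj ℤ 0 A n)).range ↔ x.sad = 0 ∧ x.dotSad = 0 := by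
  constructor
  · rintro ⟨f, rfl⟩
    rw [← normalForm_evalMat f, evalMat_normalForm]
    cases A <;> exact ⟨rfl, rfl⟩
  · rintro ⟨h, h'⟩
    refine ⟨normalForm A A m n x, ?_⟩
    rw [evalMat_normalForm]
    cases A <;> ext <;> simp [h, h']

theorem mem_amplitudes_zero_zero (x : DotRing) :
    x ∈ amplitudes 0 0 ↔ x.sad = 0 ∧ x.dotSad = 0 :=
  mem_amplitudes_self (A := .straight) x

theorem mem_amplitudes_pos_pos {p q : ℤ} (hp : 0 < p) (hq : 0 < q) (x : DotRing) :
    x ∈ amplitudes p q ↔ x.sad = 0 ∧ x.dotSad = 0 := by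
  obtain ⟨n, rfl⟩ := Int.eq_succ_of_zero_lt hp
  obtain ⟨m, rfl⟩ := Int.eq_succ_of_zero_lt hq
  exact mem_amplitudes_self (A := .turnback) x

theorem mem_amplitudes_zero_pos {q : ℤ} (hq : 0 < q) (x : DotRing) :
    x ∈ amplitudes 0 q ↔ x.one = 0 ∧ x.fst = 0 ∧ x.snd = 0 ∧ x.both = 0 := by
  obtain ⟨m, rfl⟩ := Int.eq_succ_of_zero_lt hq
  constructor
  · rintro ⟨f, rfl⟩
    have h := (congrArg evalMat (normalForm_evalMat (A := .straight) (B := .turnback) f).symm).trans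
      (evalMat_normalForm _)
    rw [h]
    exact ⟨rfl, rfl, rfl, rfl⟩
  · rintro ⟨h1, h2, h3, h4⟩
    refine ⟨normalForm .straight .turnback _ _ x, (evalMat_normalForm x).trans ?_⟩
    ext <;> simp [h1, h2, h3, h4]

theorem mem_amplitudes_pos_zero {p : ℤ} (hp : 0 < p) (x : DotRing) :
    x ∈ amplitudes p 0 ↔ x.one = 0 ∧ x.fst = 0 ∧ x.snd = 0 ∧ x.both = 0 := by
  obtain ⟨m, rfl⟩ := Int.eq_succ_of_zero_lt hp
  constructor
  · rintro ⟨f, rfl⟩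
    have h := (congrArg evalMat (normalForm_evalMat (A := .turnback) (B := .straight) f).symm).trans
      (evalMat_normalForm _)
    rw [h]
    exact ⟨rfl, rfl, rfl, rfl⟩
  · rintro ⟨h1, h2, h3, h4⟩
    refine ⟨normalForm .turnback .straight _ _ x, (evalMat_normalForm x).trans ?_⟩
    ext <;> simp [h1, h2, h3, h4]

/-- The value of the differential `C_p → C_{p + 1}`. -/
def dVal (p : ℤ) : DotRing := evalMat ((P₂ ℤ 0).d p (p + 1))

theorem dVal_mem (p : ℤ) : dVal p ∈ amplitudes p (p + 1) := ⟨_, rfl⟩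

theorem dVal_mul_dVal (p : ℤ) : dVal p * dVal (p + 1) = 0 :=
  (evalMat_comp (N := chainObj ℤ 0 (p + 1)) _ _).symm.trans
    ((congrArg evalMat ((P₂ ℤ 0).d_comp_d p (p + 1) (p + 1 + 1))).trans (map_zero _))

theorem dVal_eq (p : ℤ) : dVal p = evalMat (chainD ℤ 0 p (p + 1)) :=
  congrArg evalMat (if_pos rfl)

theorem dVal_of_neg {p : ℤ} (hp : p < 0) : dVal p = 0 :=
  eq_zero_of_mem_amplitudes (.inl hp) (dVal_mem p)

theorem dVal_zero : dVal 0 = σ :=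
  (dVal_eq 0).trans (evalMat_qHom (m := 0) (n := 1) saddle)

theorem dVal_of_odd {p : ℤ} (hp : 0 < p) (h : Odd p) : dVal p = t - t' := by
  obtain ⟨n, rfl⟩ := Int.eq_succ_of_zero_lt hp
  rw [dVal_eq]
  change evalMat (dotMap ℤ 0 (n + 1) _ _) = _
  rw [dotMap, if_pos (by exact_mod_cast h), map_sub, evalMat_qHom, evalMat_qHom]
  rfl

theorem dVal_of_even {p : ℤ} (hp : 0 < p) (h : Even p) : dVal p = t + t' := by
  obtain ⟨n, rfl⟩ := Int.eq_succ_of_zero_lt hp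
  rw [dVal_eq]
  change evalMat (dotMap ℤ 0 (n + 1) _ _) = _
  rw [dotMap, if_neg (by rw [Nat.not_odd_iff_even]; exact_mod_cast h), map_add, evalMat_qHom,
    evalMat_qHom]
  rfl

/-- Exactness of the complex `Hom(P₂, C_q)` for `q > 0`, that is of `Hom(P₂, turnback)`. -/
theorem exists_dVal_mul_eq {p q : ℤ} (hp : 0 ≤ p) (hq : 0 < q) {x : DotRing}
    (hx : x ∈ amplitudes p q) (h : dVal (p - 1) * x = 0) :
    ∃ y ∈ amplitudes (p + 1) q, dVal p * y = x := by
  simp only [mem_amplitudes_pos_pos (show 0 < p + 1 by lia) hq]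
  obtain rfl | hp := hp.eq_or_lt
  · rw [mem_amplitudes_zero_pos hq] at hx
    refine ⟨⟨x.sad, x.dotSad, 0, 0, 0, 0⟩, ⟨rfl, rfl⟩, ?_⟩
    rw [dVal_zero]
    ext <;> simp [mul_def, σ, hx]
  rw [mem_amplitudes_pos_pos hp hq] at hx
  obtain ⟨hx, hx'⟩ := hx
  -- The annihilators of `σ` and of `t + t'` are generated by `t - t'`.
  have hodd (h1 : x.one = 0) (h2 : x.fst + x.snd = 0) (hp' : Odd p) :
      ∃ y : DotRing, (y.sad = 0 ∧ y.dotSad = 0) ∧ dVal p * y = x := by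
    refine ⟨⟨x.fst, 0, x.both, 0, 0, 0⟩, ⟨rfl, rfl⟩, ?_⟩
    rw [dVal_of_odd hp hp']
    ext <;> simp [mul_def, sub_def, t, t', *]
    lia
  obtain rfl | hp1 := (show 1 ≤ p from hp).eq_or_lt
  · rw [sub_self, dVal_zero] at h
    simp only [mul_def, σ, DotRing.ext_iff, zero_def] at h
    exact hodd (by lia) (by lia) odd_one
  rcases Int.even_or_odd p with hp' | hp'
  · rw [dVal_of_odd (by lia) (by grind)] at h
    simp only [mul_def, sub_def, t, t', DotRing.ext_iff, zero_def] at h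
    refine ⟨⟨x.fst, 0, x.both, 0, 0, 0⟩, ⟨rfl, rfl⟩, ?_⟩
    rw [dVal_of_even hp hp']
    ext <;> simp [mul_def, add_def, t, t', *] <;> lia
  · rw [dVal_of_even (by lia) (by grind)] at h
    simp only [mul_def, add_def, t, t', DotRing.ext_iff, zero_def] at h
    exact hodd (by lia) (by lia) hp'

/-- The sign `(-1) ^ k`. -/
def sgn (k : ℤ) : DotRing := (k.negOnePow : ℤ)

theorem sgn_mul_self (k : ℤ) : sgn k * sgn k = 1 := by
  rw [sgn, ← Int.cast_mul, Int.units_coe_mul_self, Int.cast_one]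

theorem sgn_succ (k : ℤ) : sgn (k + 1) = -sgn k := by simp [sgn, Int.negOnePow_succ]

theorem sgn_mul_mem {p q : ℤ} (k : ℤ) {x : DotRing} (hx : x ∈ amplitudes p q) :
    sgn k * x ∈ amplitudes p q := by
  rw [sgn, ← zsmul_eq_mul]
  exact AddSubgroup.zsmul_mem _ hx _

/-- The value of the component `C_p → C_{p + k}` of a cochain of degree `k`. -/
def coeff {k : ℤ} (z : Cochain (P₂ ℤ 0) (P₂ ℤ 0) k) (p : ℤ) : DotRing :=
  evalMat (z.v p (p + k) rfl)

section Coeff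

variable {k l m : ℤ}

theorem evalMat_v (z : Cochain (P₂ ℤ 0) (P₂ ℤ 0) k) (p q : ℤ) (h : p + k = q) :
    evalMat (z.v p q h) = coeff z p := by
  subst h
  rfl

theorem coeff_mem (z : Cochain (P₂ ℤ 0) (P₂ ℤ 0) k) (p : ℤ) :
    coeff z p ∈ amplitudes p (p + k) := ⟨_, rfl⟩

theorem ext_coeff {z z' : Cochain (P₂ ℤ 0) (P₂ ℤ 0) k} (h : ∀ p, coeff z p = coeff z' p) :
    z = z' := by
  refine Cochain.ext _ _ fun p q hpq => evalMat_injective p q ?_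
  exact (evalMat_v z p q hpq).trans ((h p).trans (evalMat_v z' p q hpq).symm)

theorem exists_coeff_eq (f : ℤ → DotRing) (hf : ∀ p, f p ∈ amplitudes p (p + k)) :
    ∃ z : Cochain (P₂ ℤ 0) (P₂ ℤ 0) k, ∀ p, coeff z p = f p := by
  choose g hg using hf
  exact ⟨Cochain.mk fun p q h => g p ≫ eqToHom (congrArg (chainObj ℤ 0) h), fun p =>
    (congrArg evalMat (Category.comp_id (g p))).trans (hg p)⟩

theorem coeff_add (z z' : Cochain (P₂ ℤ 0) (P₂ ℤ 0) k) (p : ℤ) :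
    coeff (z + z') p = coeff z p + coeff z' p := map_add evalMat _ _

theorem coeff_sub (z z' : Cochain (P₂ ℤ 0) (P₂ ℤ 0) k) (p : ℤ) :
    coeff (z - z') p = coeff z p - coeff z' p := map_sub evalMat _ _

theorem coeff_zsmul (n : ℤ) (z : Cochain (P₂ ℤ 0) (P₂ ℤ 0) k) (p : ℤ) :
    coeff (n • z) p = n • coeff z p := map_zsmul evalMat _ _

theorem coeff_zero (p : ℤ) : coeff (0 : Cochain (P₂ ℤ 0) (P₂ ℤ 0) k) p = 0 := map_zero evalMat

theorem coeff_comp (z : Cochain (P₂ ℤ 0) (P₂ ℤ 0) k) (z' : Cochain (P₂ ℤ 0) (P₂ ℤ 0) l)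
    (h : k + l = m) (p : ℤ) : coeff (z.comp z' h) p = coeff z p * coeff z' (p + k) := by
  subst h
  rw [← evalMat_v _ p (p + k + l) (by lia), Cochain.comp_v _ _ _ p (p + k) (p + k + l) rfl rfl]
  exact evalMat_comp (N := chainObj ℤ 0 (p + k)) _ _

theorem coeff_δ (z : Cochain (P₂ ℤ 0) (P₂ ℤ 0) k) (h : k + 1 = l) (p : ℤ) :
    coeff (δ k l z) p = coeff z p * dVal (p + k) + sgn l * (dVal p * coeff z (p + 1)) := by
  subst h
  rw [← evalMat_v _ p (p + k + 1) (by lia),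
    δ_v k (k + 1) rfl z p (p + k + 1) (by lia) (p + k) (p + 1) (by lia) rfl]
  refine (map_add evalMat _ _).trans (congrArg₂ (· + ·) ?_ ?_)
  · exact evalMat_comp (N := chainObj ℤ 0 (p + k)) _ _
  · have h : evalMat ((P₂ ℤ 0).d p (p + 1) ≫ z.v (p + 1) (p + k + 1) (by lia)) =
        dVal p * coeff z (p + 1) :=
      (evalMat_comp (N := chainObj ℤ 0 (p + 1)) _ _).trans
        (congrArg (dVal p * ·) (evalMat_v z (p + 1) (p + k + 1) (by lia)))
    rw [← h, sgn, ← zsmul_eq_mul]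
    exact map_zsmul evalMat ((k + 1).negOnePow : ℤ) _

end Coeff

theorem coeff_bCochain {p : ℤ} (hp : 0 ≤ p) : coeff (bCochain ℤ 0) p = t := by
  rw [← evalMat_v _ p p (add_zero p)]
  obtain ⟨n, rfl⟩ := Int.eq_ofNat_of_zero_le hp
  cases n with
  | zero => exact evalMat_qHom leftDot
  | succ n => exact evalMat_qHom topDot

theorem coeff_uCochain_two : coeff (uCochain ℤ 0) 2 = σ := by
  rw [← evalMat_v _ 2 0 rfl]
  exact evalMat_qHom cosaddle

theorem coeff_uCochain {p : ℤ} (hp : 2 < p) : coeff (uCochain ℤ 0) p = 1 := by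
  obtain ⟨n, rfl⟩ : ∃ n : ℕ, p = .ofNat (n + 3) := ⟨(p - 3).toNat, by simp; lia⟩
  rw [← evalMat_v _ (.ofNat (n + 3)) (.ofNat (n + 1)) (by simp; lia)]
  exact evalMat_qHom turnbackId

theorem coeff_wCochain_three : coeff (wCochain ℤ 0) 3 = t * σ := by
  rw [← evalMat_v _ 3 0 rfl]
  exact evalMat_qHom dottedCosaddle

theorem coeff_wCochain {p : ℤ} (hp : 3 < p) : coeff (wCochain ℤ 0) p = t := by
  obtain ⟨n, rfl⟩ : ∃ n : ℕ, p = .ofNat (n + 4) := ⟨(p - 4).toNat, by simp; lia⟩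
  rw [← evalMat_v _ (.ofNat (n + 4)) (.ofNat (n + 1)) (by simp; lia)]
  exact evalMat_qHom topDot

theorem coeff_ofHom_id_zero : coeff (Cochain.ofHom (𝟙 (P₂ ℤ 0))) 0 = 1 := by
  rw [← evalMat_v _ 0 0 rfl, Cochain.ofHom_v]
  have h : 𝟙 (qObj ℤ 0 .straight 0) = qHom ℤ 0 0 0 (.decoratedId .straight 0 0) :=
    ((Mat_.embedding (Cob ℤ 0)).map_id _).symm.trans (congrArg _
      ((CategoryTheory.Quotient.functor (cobRel ℤ 0)).map_id _).symm)
  exact (congrArg evalMat h).trans (evalMat_qHom _)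

theorem coeff_eq_zero {k : ℤ} (z : Cochain (P₂ ℤ 0) (P₂ ℤ 0) k) {p : ℤ} (h : p < 0 ∨ p + k < 0) :
    coeff z p = 0 := eq_zero_of_mem_amplitudes h (coeff_mem z p)

/-! ### Cocycles and coboundaries -/

open DotRing

section Criterion

variable {k : ℤ}

theorem coeff_cocycle (z : Cocycle (P₂ ℤ 0) (P₂ ℤ 0) k) (p : ℤ) :
    coeff (z : Cochain (P₂ ℤ 0) (P₂ ℤ 0) k) p * dVal (p + k) =
      sgn k * (dVal p * coeff (z : Cochain (P₂ ℤ 0) (P₂ ℤ 0) k) (p + 1)) := by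
  have h := coeff_δ (z : Cochain (P₂ ℤ 0) (P₂ ℤ 0) k) rfl p
  rw [Cocycle.δ_eq_zero, coeff_zero, sgn_succ] at h
  linear_combination -h

/-- The component of a cocycle with values in `C_0` is a cocycle of `Hom(P₂, C_0)`. -/
theorem dVal_mul_coeff_cocycle (z : Cocycle (P₂ ℤ 0) (P₂ ℤ 0) k) :
    dVal (-k - 1) * coeff (z : Cochain (P₂ ℤ 0) (P₂ ℤ 0) k) (-k) = 0 := by
  have h := coeff_cocycle z (-k - 1)
  rw [coeff_eq_zero _ (.inr (by lia)), zero_mul, show -k - 1 + 1 = -k by lia] at h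
  linear_combination (-sgn k) * h - dVal (-k - 1) * coeff (z : Cochain _ _ k) (-k) * sgn_mul_self k

/-- The step of the construction of a primitive `g` of `z`: if the equation for the component
`C_{p - 1} → C_{p + k - 1}` of `δ g = z` holds, then the next one can be solved. -/
theorem exists_next_coeff (z : Cocycle (P₂ ℤ 0) (P₂ ℤ 0) k)
    (hz : coeff (z : Cochain (P₂ ℤ 0) (P₂ ℤ 0) k) (-k) = 0) {p : ℤ} (hp : 0 ≤ p) {x x' : DotRing}
    (hx : x ∈ amplitudes p (p + k - 1))
    (h : sgn k * (dVal (p - 1) * x) =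
      coeff (z : Cochain (P₂ ℤ 0) (P₂ ℤ 0) k) (p - 1) - x' * dVal (p + k - 2)) :
    ∃ y ∈ amplitudes (p + 1) (p + k), sgn k * (dVal p * y) =
      coeff (z : Cochain (P₂ ℤ 0) (P₂ ℤ 0) k) p - x * dVal (p + k - 1) := by
  rcases lt_trichotomy (p + k) 0 with hk | hk | hk
  · refine ⟨0, zero_mem _, ?_⟩
    rw [coeff_eq_zero _ (.inr hk), eq_zero_of_mem_amplitudes (.inr (by lia)) hx]
    simp
  · obtain rfl : p = -k := by lia
    refine ⟨0, zero_mem _, ?_⟩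
    rw [hz, eq_zero_of_mem_amplitudes (.inr (by lia)) hx]
    simp
  · have hd := dVal_mul_dVal (p + k - 2)
    have hc := coeff_cocycle z (p - 1)
    rw [show p + k - 2 + 1 = p + k - 1 by lia] at hd
    rw [show p - 1 + k = p + k - 1 by lia, sub_add_cancel] at hc
    have hxd := mul_mem_amplitudes hx (dVal_mem (p + k - 1))
    rw [show p + k - 1 + 1 = p + k by lia] at hxd
    obtain ⟨y, hy, hy'⟩ := exists_dVal_mul_eq hp hk (sgn_mul_mem k (sub_mem (coeff_mem _ p) hxd)) (by
      linear_combination (-1 : DotRing) * dVal (p + k - 1) * h - hc + x' * hd)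
    refine ⟨y, hy, ?_⟩
    rw [hy', ← mul_assoc, sgn_mul_self, one_mul]

/-- A cocycle is determined up to a coboundary by its component with values in `C_0`. -/
theorem exists_δ_eq_of_coeff_eq_zero (z : Cocycle (P₂ ℤ 0) (P₂ ℤ 0) k)
    (hz : coeff (z : Cochain (P₂ ℤ 0) (P₂ ℤ 0) k) (-k) = 0) :
    ∃ g : Cochain (P₂ ℤ 0) (P₂ ℤ 0) (k - 1), δ (k - 1) k g = z := by
  let S (n : ℕ) := {x : DotRing // x ∈ amplitudes n (n + k - 1) ∧
    ∃ x', sgn k * (dVal (n - 1) * x) =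
      coeff (z : Cochain (P₂ ℤ 0) (P₂ ℤ 0) k) (n - 1) - x' * dVal (n + k - 2)}
  have step (n : ℕ) (x : S n) : ∃ y : S (n + 1), sgn k * (dVal n * y.1) =
      coeff (z : Cochain (P₂ ℤ 0) (P₂ ℤ 0) k) n - x.1 * dVal (n + k - 1) := by
    obtain ⟨x, hx, x', h⟩ := x
    obtain ⟨y, hy, hy'⟩ := exists_next_coeff z hz (Int.natCast_nonneg n) hx h
    refine ⟨⟨y, ?_, x, ?_⟩, hy'⟩
    · rwa [Nat.cast_succ, show (n + 1 + k - 1 : ℤ) = n + k by lia]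
    · rwa [Nat.cast_succ, show (n + 1 + k - 2 : ℤ) = n + k - 1 by lia, add_sub_cancel_right]
  choose next hnext using step
  obtain ⟨a, ha, hrel⟩ : ∃ a : ℕ → DotRing, (∀ n : ℕ, a n ∈ amplitudes n (n + k - 1)) ∧
      ∀ n : ℕ, sgn k * (dVal n * a (n + 1)) =
        coeff (z : Cochain (P₂ ℤ 0) (P₂ ℤ 0) k) n - a n * dVal (n + k - 1) := by
    let a : (n : ℕ) → S n := Nat.rec ⟨0, zero_mem _, 0, by
      rw [coeff_eq_zero _ (.inl (by simp))]
      simp⟩ next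
    exact ⟨fun n => (a n).1, fun n => (a n).2.1, fun n => hnext n (a n)⟩
  obtain ⟨g, hg⟩ := exists_coeff_eq (k := k - 1)
    (fun | .ofNat n => a n | .negSucc _ => 0) (fun
      | .ofNat n => by
        have h := ha n
        rwa [add_sub_assoc] at h
      | .negSucc _ => zero_mem _)
  refine ⟨g, ext_coeff fun p => ?_⟩
  rw [coeff_δ g (by lia), hg, hg]
  match p with
  | .ofNat n =>
    have h := hrel n
    rw [show (n + k - 1 : ℤ) = n + (k - 1) by lia] at h
    change a n * dVal (n + (k - 1)) + sgn k * (dVal n * a (n + 1)) =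
      coeff (z : Cochain (P₂ ℤ 0) (P₂ ℤ 0) k) n
    linear_combination h
  | .negSucc n =>
    rw [dVal_of_neg (Int.negSucc_lt_zero n), coeff_eq_zero _ (.inl (Int.negSucc_lt_zero n))]
    simp

/-- The classification of coboundaries: the homology of `End(P₂)` is that of `Hom(P₂, C_0)`. -/
theorem mem_coboundaries_iff (z : Cocycle (P₂ ℤ 0) (P₂ ℤ 0) k) :
    z ∈ coboundaries (P₂ ℤ 0) (P₂ ℤ 0) k ↔ ∃ y ∈ amplitudes (1 - k) 0,
      coeff (z : Cochain (P₂ ℤ 0) (P₂ ℤ 0) k) (-k) = dVal (-k) * y := by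
  constructor
  · rintro ⟨l, hl, g, hg⟩
    have h := coeff_mem g (-k + 1)
    rw [show -k + 1 + l = 0 by lia] at h
    refine ⟨sgn k * coeff g (-k + 1), ?_, ?_⟩
    · rw [show 1 - k = -k + 1 by lia]
      exact sgn_mul_mem k h
    · rw [← hg, coeff_δ g hl, coeff_eq_zero g (.inr (by lia))]
      ring
  · rintro ⟨y, hy, hzy⟩
    obtain ⟨g, hg⟩ := exists_coeff_eq (k := k - 1) (fun p => if p = 1 - k then sgn k * y else 0)
      (fun p => by
        split_ifs with h
        · subst h
          rw [show 1 - k + (k - 1) = 0 by lia]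
          exact sgn_mul_mem k hy
        · exact zero_mem _)
    have hδ : δ k (k + 1) (δ (k - 1) k g) = 0 := δ_δ _ _ _ g
    obtain ⟨g', hg'⟩ := exists_δ_eq_of_coeff_eq_zero (z - Cocycle.mk (δ (k - 1) k g) _ rfl hδ) (by
      rw [Cocycle.coe_sub, coeff_sub, hzy]
      change _ - coeff (δ (k - 1) k g) (-k) = 0
      rw [coeff_δ g (by lia), coeff_eq_zero g (.inr (by lia)), hg, if_pos (by lia)]
      linear_combination (-dVal (-k) * y) * sgn_mul_self k)
    refine ⟨k - 1, by lia, g' + g, ?_⟩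
    rw [δ_add, hg', Cocycle.coe_sub]
    exact sub_add_cancel _ _

theorem mk_eq_mk_of_coeff_eq {z z' : Cocycle (P₂ ℤ 0) (P₂ ℤ 0) k}
    (h : coeff (z : Cochain (P₂ ℤ 0) (P₂ ℤ 0) k) (-k) =
      coeff (z' : Cochain (P₂ ℤ 0) (P₂ ℤ 0) k) (-k)) :
    CohomologyClass.mk z = CohomologyClass.mk z' := by
  rw [← sub_eq_zero, ← CohomologyClass.mk_sub, CohomologyClass.mk_eq_zero_iff,
    mem_coboundaries_iff]
  exact ⟨0, zero_mem _, by rw [Cocycle.coe_sub, coeff_sub, h]; simp⟩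

end Criterion

theorem δ_bCochain : δ 0 1 (bCochain ℤ 0) = 0 := by
  refine ext_coeff fun p => ?_
  rw [coeff_δ _ (show (0 : ℤ) + 1 = 1 by lia), coeff_zero]
  rcases lt_or_ge p 0 with hp | hp
  · rw [dVal_of_neg hp, coeff_eq_zero _ (.inl hp)]
    simp
  · rw [coeff_bCochain hp, coeff_bCochain (by lia), add_zero, show (1 : ℤ) = 0 + 1 from rfl,
      sgn_succ]
    simp [sgn, mul_comm]

theorem δ_uCochain : δ (-2) (-1) (uCochain ℤ 0) = 0 := by
  refine ext_coeff fun p => ?_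
  have hs : sgn (-1) = -1 := by simp [sgn]
  rw [coeff_δ _ (show (-2 : ℤ) + 1 = -1 by lia), coeff_zero, hs]
  rcases lt_or_ge p 1 with hp | hp
  · rw [coeff_eq_zero _ (.inr (by lia)), coeff_eq_zero _ (.inr (by lia))]
    simp
  obtain rfl | hp := hp.eq_or_lt
  · rw [coeff_eq_zero _ (.inr (by lia)), one_add_one_eq_two, coeff_uCochain_two,
      dVal_of_odd one_pos odd_one]
    rfl
  obtain rfl | hp := (show 2 ≤ p from hp).eq_or_lt
  · rw [coeff_uCochain_two, coeff_uCochain (by lia), dVal_of_even two_pos even_two,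
      add_neg_cancel, dVal_zero]
    rfl
  · rw [coeff_uCochain hp, coeff_uCochain (by lia)]
    rcases Int.even_or_odd p with h | h
    · rw [dVal_of_even (by lia) h, dVal_of_even (by lia) (by grind)]
      ring
    · rw [dVal_of_odd (by lia) h, dVal_of_odd (by lia) (by grind)]
      ring

theorem δ_wCochain : δ (-3) (-2) (wCochain ℤ 0) = 0 := by
  refine ext_coeff fun p => ?_
  have hs : sgn (-2) = 1 := by simp [sgn, Int.negOnePow_even (-2) (by decide)]
  rw [coeff_δ _ (show (-3 : ℤ) + 1 = -2 by lia), coeff_zero, hs]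
  rcases lt_or_ge p 2 with hp | hp
  · rw [coeff_eq_zero _ (.inr (by lia)), coeff_eq_zero _ (.inr (by lia))]
    simp
  obtain rfl | hp := hp.eq_or_lt
  · rw [coeff_eq_zero _ (.inr (by lia)), two_add_one_eq_three, coeff_wCochain_three,
      dVal_of_even two_pos even_two]
    rfl
  obtain rfl | hp := (show 3 ≤ p from hp).eq_or_lt
  · rw [coeff_wCochain_three, coeff_wCochain (by lia), dVal_of_odd three_pos (by decide),
      add_neg_cancel, dVal_zero]
    rfl
  · rw [coeff_wCochain hp, coeff_wCochain (by lia)]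
    rcases Int.even_or_odd p with h | h
    · rw [dVal_of_even (by lia) h, dVal_of_odd (by lia) (by grind)]
      rfl
    · rw [dVal_of_odd (by lia) h, dVal_of_even (by lia) (by grind)]
      rfl

/-! ### The homology ring -/

open DotRing Polynomial

/-- The homology class of `bCochain`. -/
def bClass : EndHomology (P₂ ℤ 0) := homologyClass _ (bCochain ℤ 0) δ_bCochain

/-- The homology class of `uCochain`. -/
def uClass : EndHomology (P₂ ℤ 0) := homologyClass _ (uCochain ℤ 0) δ_uCochain

/-- The homology class of `wCochain`. -/
def wClass : EndHomology (P₂ ℤ 0) := homologyClass _ (wCochain ℤ 0) δ_wCochain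

/-- `IsRep x k c`: the element `x` of the homology is homogeneous of degree `k`, and it has a
representative whose component `C_{-k} → C_0` has the value `c`. -/
def IsRep (x : EndHomology (P₂ ℤ 0)) (k : ℤ) (c : DotRing) : Prop :=
  ∃ z : Cocycle (P₂ ℤ 0) (P₂ ℤ 0) k, x = DirectSum.of _ k (CohomologyClass.mk z) ∧
    coeff (z : Cochain (P₂ ℤ 0) (P₂ ℤ 0) k) (-k) = c

section IsRep

variable {x y : EndHomology (P₂ ℤ 0)} {k l : ℤ} {c d : DotRing}

theorem IsRep.eq (hx : IsRep x k c) (hy : IsRep y k c) : x = y := by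
  obtain ⟨z, rfl, hz⟩ := hx
  obtain ⟨z', rfl, hz'⟩ := hy
  rw [mk_eq_mk_of_coeff_eq (hz.trans hz'.symm)]

theorem isRep_zero : IsRep 0 k 0 := ⟨0, by simp, coeff_zero _⟩

theorem IsRep.add (hx : IsRep x k c) (hy : IsRep y k d) : IsRep (x + y) k (c + d) := by
  obtain ⟨z, rfl, rfl⟩ := hx
  obtain ⟨z', rfl, rfl⟩ := hy
  exact ⟨z + z', by rw [CohomologyClass.mk_add, map_add], coeff_add _ _ _⟩

theorem IsRep.zsmul (hx : IsRep x k c) (n : ℤ) : IsRep (n • x) k (n • c) := by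
  obtain ⟨z, rfl, rfl⟩ := hx
  refine ⟨n • z, ?_, coeff_zsmul _ _ _⟩
  have h : CohomologyClass.mk (n • z) = n • CohomologyClass.mk z :=
    map_zsmul (CohomologyClass.mkAddMonoidHom _ _ k) n z
  rw [h, map_zsmul]

theorem IsRep.sub (hx : IsRep x k c) (hy : IsRep y k d) : IsRep (x - y) k (c - d) := by
  simpa [sub_eq_add_neg] using! hx.add (hy.zsmul (-1))

theorem IsRep.congr (hx : IsRep x k c) (hk : k = l) (hc : c = d) : IsRep x l d :=
  hk ▸ hc ▸ hx

/-- The component with values in `C_0` of a product. -/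
theorem IsRep.mul_homologyClass (hx : IsRep x k c) {f : Cochain (P₂ ℤ 0) (P₂ ℤ 0) l}
    (hf : δ l (l + 1) f = 0) {m : ℤ} (hm : k + l = m) :
    IsRep (x * homologyClass _ f hf) m (coeff f (-m) * c) := by
  subst hm
  obtain ⟨z, rfl, rfl⟩ := hx
  refine ⟨cocycleMul _ z (Cocycle.mk f _ rfl hf), DirectSum.of_mul_of _ _, ?_⟩
  rw [coe_cocycleMul, coeff_comp]
  congr 2
  lia

theorem IsRep.eq_zero_iff (hx : IsRep x k c) :
    x = 0 ↔ ∃ y ∈ amplitudes (1 - k) 0, c = dVal (-k) * y := by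
  obtain ⟨z, rfl, rfl⟩ := hx
  rw [← mem_coboundaries_iff, ← CohomologyClass.mk_eq_zero_iff]
  exact map_eq_zero_iff _ (DirectSum.of_injective k)

theorem IsRep.component_self (hx : IsRep x k c) : IsRep (DirectSum.of _ k (x k)) k c := by
  obtain ⟨z, rfl, rfl⟩ := hx
  exact ⟨z, by rw [DirectSum.of_eq_same], rfl⟩

theorem IsRep.component_of_ne (hx : IsRep x k c) (h : k ≠ l) :
    IsRep (DirectSum.of _ l (x l)) l 0 := by
  obtain ⟨z, rfl, rfl⟩ := hx
  rw [DirectSum.of_eq_of_ne _ _ _ h.symm, map_zero]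
  exact isRep_zero

end IsRep

theorem isRep_one : IsRep 1 0 1 := ⟨_, DirectSum.one_def _, coeff_ofHom_id_zero⟩

theorem isRep_bClass : IsRep bClass 0 t := ⟨_, rfl, coeff_bCochain le_rfl⟩

theorem isRep_uClass : IsRep uClass (-2) σ := ⟨_, rfl, coeff_uCochain_two⟩

theorem isRep_wClass : IsRep wClass (-3) (t * σ) := ⟨_, rfl, coeff_wCochain_three⟩

/-- The value of the component `C_{2 i} → C_0` of `u ^ i`. -/
def uPowVal (i : ℕ) : DotRing := if i = 0 then 1 else σ

theorem isRep_uClass_pow (i : ℕ) : IsRep (uClass ^ i) (-2 * i) (uPowVal i) := by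
  induction i with
  | zero => simpa using! isRep_one
  | succ i ih =>
    rw [pow_succ]
    refine (ih.mul_homologyClass δ_uCochain (m := -2 * (i + 1 : ℕ)) (by push_cast; ring)).congr
      rfl ?_
    rcases i.eq_zero_or_pos with rfl | hi
    · change coeff (uCochain ℤ 0) 2 * 1 = σ
      rw [coeff_uCochain_two, mul_one]
    · rw [coeff_uCochain (by lia), uPowVal, uPowVal, if_neg (by lia), if_neg (by lia), one_mul]

theorem isRep_uClass_pow_mul_bClass (i : ℕ) :
    IsRep (uClass ^ i * bClass) (-2 * i) (t * uPowVal i) := by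
  have h := (isRep_uClass_pow i).mul_homologyClass δ_bCochain (add_zero _)
  rwa [coeff_bCochain (by lia)] at h

theorem isRep_uClass_pow_mul_wClass (i : ℕ) :
    IsRep (uClass ^ i * wClass) (-2 * i - 3) (t * σ) := by
  refine ((isRep_uClass_pow i).mul_homologyClass δ_wCochain (m := -2 * i - 3) (by ring)).congr
    rfl ?_
  rcases i.eq_zero_or_pos with rfl | hi
  · change coeff (wCochain ℤ 0) 3 * 1 = t * σ
    rw [coeff_wCochain_three, mul_one]
  · rw [coeff_wCochain (by lia), uPowVal, if_neg (by lia)]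

/-! ### Products of the generators -/

theorem uClass_mul_wClass : uClass * wClass = wClass * uClass := by
  have h := isRep_uClass.mul_homologyClass δ_wCochain (m := -5) rfl
  have h' := isRep_wClass.mul_homologyClass δ_uCochain (m := -5) rfl
  rw [coeff_wCochain (by norm_num)] at h
  rw [coeff_uCochain (by norm_num), one_mul] at h'
  exact h.eq h'

theorem uClass_mul_bClass : uClass * bClass = bClass * uClass := by
  have h := isRep_uClass.mul_homologyClass δ_bCochain (m := -2) rfl
  have h' := isRep_bClass.mul_homologyClass δ_uCochain (m := -2) rfl
  rw [coeff_bCochain (by norm_num)] at h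
  rw [neg_neg, coeff_uCochain_two, mul_comm] at h'
  exact h.eq h'

theorem wClass_mul_bClass : wClass * bClass = 0 := by
  have h := isRep_wClass.mul_homologyClass δ_bCochain (m := -3) rfl
  rw [coeff_bCochain (by norm_num), ← mul_assoc, t_mul_t, zero_mul] at h
  exact h.eq isRep_zero

theorem bClass_mul_wClass : bClass * wClass = 0 := by
  have h := isRep_bClass.mul_homologyClass δ_wCochain (m := -3) rfl
  rw [neg_neg, coeff_wCochain_three, mul_right_comm, t_mul_t, zero_mul] at h
  exact h.eq isRep_zero

theorem bClass_mul_bClass : bClass * bClass = 0 := by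
  have h := isRep_bClass.mul_homologyClass δ_bCochain (m := 0) rfl
  rw [coeff_bCochain (by norm_num), t_mul_t] at h
  exact h.eq isRep_zero

theorem wClass_mul_wClass : wClass * wClass = 0 := by
  have h := isRep_wClass.mul_homologyClass δ_wCochain (m := -6) rfl
  rw [coeff_wCochain (by norm_num), ← mul_assoc, t_mul_t, zero_mul] at h
  exact h.eq isRep_zero

/-! ### The additive structure -/

/-- The map `(p, q, r) ↦ p(u) + q(u) w + r(u) b`. -/
def combination : ℤ[X] × ℤ[X] × ℤ[X] →+ EndHomology (P₂ ℤ 0) where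
  toFun x := aeval uClass x.1 + aeval uClass x.2.1 * wClass + aeval uClass x.2.2 * bClass
  map_zero' := by simp
  map_add' x y := by
    simp only [Prod.fst_add, Prod.snd_add, map_add, add_mul]
    abel

/-- A homogeneous class is a combination of those `u ^ i`, `u ^ i w` and `u ^ i b` of its degree, as
its component with values in `C_0` shows. -/
theorem mem_range_combination_of_isRep {x : EndHomology (P₂ ℤ 0)} {k : ℤ} {c : DotRing}
    (hx : IsRep x k c) : x ∈ combination.range := by
  have hc : c ∈ amplitudes (-k) 0 := by
    obtain ⟨z, -, rfl⟩ := hx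
    have h := coeff_mem (z : Cochain _ _ k) (-k)
    rwa [neg_add_cancel] at h
  have hd : dVal (-k - 1) * c = 0 := by
    obtain ⟨z, -, rfl⟩ := hx
    exact dVal_mul_coeff_cocycle z
  have heven (i : ℕ) (m n : ℤ) :
      m • uClass ^ i + n • (uClass ^ i * bClass) ∈ combination.range := by
    refine ⟨(monomial i m, 0, monomial i n), ?_⟩
    simp [combination, aeval_monomial, mul_assoc]
  have hodd (i : ℕ) (n : ℤ) : n • (uClass ^ i * wClass) ∈ combination.range := by
    refine ⟨(0, monomial i n, 0), ?_⟩
    simp [combination, aeval_monomial, mul_assoc]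
  rcases lt_trichotomy k 0 with hk | rfl | hk
  · rw [mem_amplitudes_pos_zero (by lia)] at hc
    obtain ⟨h1, h2, h3, h4⟩ := hc
    rcases Int.even_or_odd' k with ⟨i, rfl | rfl⟩
    · obtain ⟨i, rfl⟩ : ∃ j : ℕ, i = -j := ⟨(-i).toNat, by lia⟩
      have h := ((isRep_uClass_pow i).zsmul c.sad).add
        ((isRep_uClass_pow_mul_bClass i).zsmul c.dotSad)
      rw [hx.eq (h.congr (by ring) ?_)]
      · exact heven i c.sad c.dotSad
      · rw [uPowVal, if_neg (by lia)]
        ext <;> simp [-zsmul_eq_mul, zsmul_def, add_def, mul_def, t, σ, *]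
    · obtain rfl | hi := (show i ≤ -1 by lia).eq_or_lt
      · rw [show (-(2 * -1 + 1) - 1 : ℤ) = 0 by norm_num, dVal_zero] at hd
        simp only [mul_def, σ, DotRing.ext_iff, zero_def] at hd
        rw [hx.eq (isRep_zero.congr rfl ?_)]
        · exact zero_mem _
        · ext <;> simp [zero_def] <;> lia
      · obtain ⟨i, rfl⟩ : ∃ j : ℕ, i = -j - 2 := ⟨(-i - 2).toNat, by lia⟩
        rw [dVal_of_even (by lia) (by grind)] at hd
        simp only [mul_def, add_def, t, t', DotRing.ext_iff, zero_def] at hd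
        rw [hx.eq (((isRep_uClass_pow_mul_wClass i).zsmul c.dotSad).congr (by ring) ?_)]
        · exact hodd i c.dotSad
        · ext <;> simp [-zsmul_eq_mul, zsmul_def, mul_def, t, σ, *]
          lia
  -- The coboundaries have the values `m (t + t') + n t t'`, so `t'` can be replaced by `-t`.
  · rw [neg_zero, mem_amplitudes_zero_zero] at hc
    have h := hx.sub ((isRep_one.zsmul c.one).add (isRep_bClass.zsmul (c.fst - c.snd)))
    have h0 := h.eq_zero_iff.2 ⟨⟨0, 0, 0, 0, c.snd, c.both⟩,
      (mem_amplitudes_pos_zero (by norm_num) _).2 ⟨rfl, rfl, rfl, rfl⟩, by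
        rw [neg_zero, dVal_zero]
        ext <;> simp [-zsmul_eq_mul, zsmul_def, sub_def, add_def, mul_def, one_def, t, σ, *]⟩
    rw [sub_eq_zero.1 h0]
    simpa using! heven 0 c.one (c.fst - c.snd)
  · rw [hx.eq_zero_iff.2 ⟨0, zero_mem _, ?_⟩]
    · exact zero_mem _
    · rw [eq_zero_of_mem_amplitudes (.inl (by lia)) hc, mul_zero]

theorem combination_surjective : Function.Surjective combination := by
  rw [← AddMonoidHom.range_eq_top, eq_top_iff]
  rintro x -
  induction x using DirectSum.induction_on with
  | zero => exact zero_mem _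
  | of k x =>
    obtain ⟨z, rfl⟩ := x.mk_surjective
    exact mem_range_combination_of_isRep ⟨z, rfl, rfl⟩
  | add x y hx hy => exact add_mem hx hy

/-- The component of degree `l` of `p(u) g`, where all `u ^ i g` are homogeneous. -/
theorem isRep_component_aeval_mul {g : EndHomology (P₂ ℤ 0)} {k : ℕ → ℤ} {c : ℕ → DotRing}
    (hg : ∀ i, IsRep (uClass ^ i * g) (k i) (c i)) (p : ℤ[X]) (l : ℤ) :
    IsRep (DirectSum.of _ l ((aeval uClass p * g) l)) l
      (p.sum fun i a => a • if k i = l then c i else 0) := by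
  induction p using Polynomial.induction_on' with
  | add p q hp hq =>
    rw [map_add, add_mul, DirectSum.add_apply, map_add]
    exact (hp.add hq).congr rfl (Polynomial.sum_add_index p q
      (fun i a => a • if k i = l then c i else 0) (fun _ => zero_smul ℤ _)
      (fun _ _ _ => add_smul _ _ _)).symm
  | monomial i a =>
    rw [Polynomial.sum_monomial_index a (fun i a => a • if k i = l then c i else 0)
      (zero_smul ℤ _), aeval_monomial, ← Algebra.smul_def, smul_mul_assoc]
    have h : IsRep (DirectSum.of _ l ((uClass ^ i * g) l)) l (if k i = l then c i else 0) := by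
      split_ifs with h
      · subst h
        exact (hg i).component_self
      · exact (hg i).component_of_ne h
    have h' := h.zsmul a
    rw [← map_zsmul] at h'
    exact h'

theorem sum_smul_ite_eq {k : ℕ → ℤ} (hk : Function.Injective k) (c : ℕ → DotRing) (p : ℤ[X])
    (j : ℕ) : (p.sum fun i a => a • if k i = k j then c i else 0) = p.coeff j • c j := by
  rw [Polynomial.sum_def, Finset.sum_eq_single j]
  · rw [if_pos rfl]
  · intro i _ hi
    rw [if_neg (hk.ne hi), smul_zero]
  · intro hj
    rw [notMem_support_iff.1 hj, zero_smul]

theorem sum_smul_ite_eq_zero {k : ℕ → ℤ} {l : ℤ} (hk : ∀ i, k i ≠ l) (c : ℕ → DotRing)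
    (p : ℤ[X]) : (p.sum fun i a => a • if k i = l then c i else 0) = 0 := by
  rw [Polynomial.sum_def]
  refine Finset.sum_eq_zero fun i _ => ?_
  rw [if_neg (hk i), smul_zero]

theorem uClass_mul_bClass_smul_two : (2 : ℤ) • (uClass * bClass) = 0 := by
  have h := (isRep_uClass.mul_homologyClass δ_bCochain (m := -2) rfl).zsmul 2
  rw [coeff_bCochain (by norm_num)] at h
  refine h.eq_zero_iff.2 ⟨σ, (mem_amplitudes_pos_zero (by norm_num) _).2 ⟨rfl, rfl, rfl, rfl⟩, ?_⟩
  rw [neg_neg, dVal_of_even two_pos even_two]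
  rfl

theorem combination_eq_zero_iff (p q r : ℤ[X]) :
    combination (p, q, r) = 0 ↔ p = 0 ∧ q = 0 ∧ r ∈ Ideal.span {(2 * X : ℤ[X])} := by
  rw [Ideal.mem_span_singleton]
  constructor
  · intro h
    -- The homogeneous components of `combination (p, q, r)`.
    have hrep (l : ℤ) := ((isRep_component_aeval_mul
      (fun i => (mul_one (uClass ^ i)).symm ▸ isRep_uClass_pow i) p l).add
        (isRep_component_aeval_mul isRep_uClass_pow_mul_wClass q l)).add
        (isRep_component_aeval_mul isRep_uClass_pow_mul_bClass r l)
    have hzero (l : ℤ) := (hrep l).eq_zero_iff.1 (by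
      rw [← map_add, ← map_add, ← DirectSum.add_apply, ← DirectSum.add_apply, mul_one]
      exact (congrArg (fun x : EndHomology (P₂ ℤ 0) => DirectSum.of _ l (x l)) h).trans
        (map_zero _))
    have hodd (j : ℕ) : q.coeff j = 0 := by
      obtain ⟨y, hy, h⟩ := hzero (-2 * j - 3)
      rw [sum_smul_ite_eq (k := fun i : ℕ => (-2 * i - 3 : ℤ)) (fun i j h => by simpa using h),
        sum_smul_ite_eq_zero (by lia), sum_smul_ite_eq_zero (by lia),
        dVal_of_odd (by lia) (by grind)] at h
      rw [mem_amplitudes_pos_zero (by lia)] at hy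
      have h' := congrArg DotRing.dotSad h
      simpa [-zsmul_eq_mul, zsmul_def, sub_def, add_def, mul_def, zero_def, t, t', σ, hy] using h'
    have heven (j : ℕ) : p.coeff j = 0 ∧ (j = 0 → r.coeff j = 0) ∧ 2 ∣ r.coeff j := by
      obtain ⟨y, hy, h⟩ := hzero (-2 * j)
      rw [sum_smul_ite_eq (k := fun i : ℕ => (-2 * i : ℤ)) (fun i j h => by simpa using h),
        sum_smul_ite_eq (k := fun i : ℕ => (-2 * i : ℤ)) (fun i j h => by simpa using h),
        sum_smul_ite_eq_zero (by lia)] at h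
      rw [mem_amplitudes_pos_zero (by lia)] at hy
      rcases j.eq_zero_or_pos with rfl | hj
      · rw [show (-(-2 * (0 : ℕ)) : ℤ) = 0 by simp, dVal_zero, uPowVal, if_pos rfl] at h
        simp [-zsmul_eq_mul, zsmul_def, add_def, mul_def, zero_def, one_def, t, σ, hy,
          DotRing.ext_iff] at h
        refine ⟨by lia, fun _ => by lia, by lia⟩
      · rw [dVal_of_even (by lia) (by grind), uPowVal, if_neg (by lia)] at h
        simp [-zsmul_eq_mul, zsmul_def, add_def, mul_def, zero_def, t, t', σ, hy,
          DotRing.ext_iff] at h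
        refine ⟨by lia, fun _ => by lia, by lia⟩
    refine ⟨Polynomial.ext fun j => (heven j).1, Polynomial.ext hodd, ?_⟩
    obtain ⟨s, rfl⟩ := X_dvd_iff.2 ((heven 0).2.1 rfl)
    rw [mul_comm]
    refine mul_dvd_mul_left X ((C_dvd_iff_dvd_coeff 2 s).2 fun j => ?_)
    simpa using (heven (j + 1)).2.2
  · rintro ⟨rfl, rfl, s, rfl⟩
    have h : aeval uClass (2 * X * s) * bClass =
        aeval uClass s * ((2 : ℤ) • (uClass * bClass)) := by
      rw [mul_comm (2 * X) s, map_mul, map_mul, aeval_X, mul_assoc]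
      congr 1
      rw [map_ofNat, two_smul, two_mul, add_mul]
    simp only [combination, AddMonoidHom.coe_mk, ZeroHom.coe_mk, map_zero, zero_mul, zero_add]
    rw [h, uClass_mul_bClass_smul_two, mul_zero]

theorem exists_addEquiv : ∃ e : (ℤ[X] × ℤ[X] × (ℤ[X] ⧸ Ideal.span {(2 * X : ℤ[X])})) ≃+
    EndHomology (P₂ ℤ 0), ∀ p q r : ℤ[X], e (p, q, Ideal.Quotient.mk _ r) =
      aeval uClass p + aeval uClass q * wClass + aeval uClass r * bClass := by
  let I := Ideal.span {(2 * X : ℤ[X])}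
  let g : ℤ[X] × ℤ[X] × ℤ[X] →+ ℤ[X] × ℤ[X] × (ℤ[X] ⧸ I) :=
    (AddMonoidHom.id _).prodMap ((AddMonoidHom.id _).prodMap (Ideal.Quotient.mk I).toAddMonoidHom)
  have hg : Function.Surjective g := by
    rintro ⟨p, q, r⟩
    obtain ⟨r, rfl⟩ := Ideal.Quotient.mk_surjective r
    exact ⟨(p, q, r), rfl⟩
  have hker (x : ℤ[X] × ℤ[X] × ℤ[X]) : combination x = 0 ↔ g x = 0 := by
    obtain ⟨p, q, r⟩ := x
    rw [combination_eq_zero_iff, ← Ideal.Quotient.eq_zero_iff_mem]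
    simp [g, I, Prod.ext_iff]
  let e := g.liftOfSurjective hg ⟨combination, fun x hx => (hker x).2 hx⟩
  have he (x) : e (g x) = combination x := g.liftOfRightInverse_comp_apply _ _ _ x
  refine ⟨AddEquiv.ofBijective e ⟨?_, ?_⟩, fun p q r => he (p, q, r)⟩
  · rw [injective_iff_map_eq_zero]
    intro y hy
    obtain ⟨x, rfl⟩ := hg y
    rwa [he, hker] at hy
  · intro y
    obtain ⟨x, rfl⟩ := combination_surjective y
    exact ⟨g x, he x⟩

theorem endHomology_mul_comm (x y : EndHomology (P₂ ℤ 0)) : x * y = y * x := by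
  have comm_aeval {a : EndHomology (P₂ ℤ 0)} (ha : Commute uClass a) (p : ℤ[X]) :
      Commute (aeval uClass p) a := by
    induction p using Polynomial.induction_on' with
    | add p q hp hq => rw [map_add]; exact hp.add_left hq
    | monomial i n =>
      rw [aeval_monomial]
      exact (Algebra.commute_algebraMap_left n a).mul_left (ha.pow_left i)
  have comm_of_gens {a : EndHomology (P₂ ℤ 0)} (hu : Commute uClass a) (hw : Commute wClass a)
      (hb : Commute bClass a) (y) : Commute y a := by
    obtain ⟨⟨p, q, r⟩, rfl⟩ := combination_surjective y
    exact ((comm_aeval hu p).add_left ((comm_aeval hu q).mul_left hw)).add_left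
      ((comm_aeval hu r).mul_left hb)
  -- The generators commute with each other, hence with all elements, hence all elements commute.
  have hu := comm_of_gens (.refl uClass) uClass_mul_wClass.symm uClass_mul_bClass.symm
  have hbw : Commute bClass wClass := bClass_mul_wClass.trans wClass_mul_bClass.symm
  have hw := comm_of_gens uClass_mul_wClass (.refl wClass) hbw
  have hb := comm_of_gens uClass_mul_bClass hbw.symm (.refl bClass)
  exact comm_of_gens (hu y).symm (hw y).symm (hb y).symm x

end SheetAlgebra

end

theorem theorem8p1 :
    ∃ (hb : δ 0 1 (SheetAlgebra.bCochain ℤ 0) = 0)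
      (hu : δ (-2) (-1) (SheetAlgebra.uCochain ℤ 0) = 0)
      (hw : δ (-3) (-2) (SheetAlgebra.wCochain ℤ 0) = 0),
      let H := SheetAlgebra.EndHomology (SheetAlgebra.P₂ ℤ 0)
      let b : H := SheetAlgebra.homologyClass _ (SheetAlgebra.bCochain ℤ 0) hb
      let u : H := SheetAlgebra.homologyClass _ (SheetAlgebra.uCochain ℤ 0) hu
      let w : H := SheetAlgebra.homologyClass _ (SheetAlgebra.wCochain ℤ 0) hw
      (∃ e : (Polynomial ℤ × Polynomial ℤ ×
            (Polynomial ℤ ⧸ Ideal.span {(2 * Polynomial.X : Polynomial ℤ)})) ≃+ H,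
          ∀ p q r : Polynomial ℤ, e (p, q, Ideal.Quotient.mk _ r) =
            Polynomial.aeval u p + Polynomial.aeval u q * w + Polynomial.aeval u r * b) ∧
        (∀ x y : H, x * y = y * x) ∧
        w * b = 0 ∧ b * b = 0 ∧ w * w = 0 := by
  exact ⟨SheetAlgebra.δ_bCochain, SheetAlgebra.δ_uCochain, SheetAlgebra.δ_wCochain,
    SheetAlgebra.exists_addEquiv, SheetAlgebra.endHomology_mul_comm,
    SheetAlgebra.wClass_mul_bClass, SheetAlgebra.bClass_mul_bClass,
    SheetAlgebra.wClass_mul_wClass⟩
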